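/- **Setting.** Let $f_0$ be a Schwarz symmetric, piecewise analytic function and $f(z;x,t)=f_0(z)+2zx+2tz^2$. For $(x,t)$ near $(x_b,t_b)$ let a Schwarz symmetric contour be given that consists of $N+1$ disjoint simple main arcs $\gamma_{m,j}$ ($0\le j\le N$) and finitely many complementary arcs $\gamma_{c,k}$ joining endpoints of main arcs, and let the genus-$N$ $g$-function $g(z;x,t)$ be a bounded Schwarz symmetric function, analytic on the Riemann sphere off the contour, with $g_++g_-=f+W_j$ on $\gamma_{m,j}$ and $g_+-g_-=\Omega_k$ on $\gamma_{c,k}$, where $W_j,\Omega_k$ are real and $W_0=0$, such that $h^N=2g-f$ satisfies $\operatorname{Im}h^N=O(|z-\alpha|^{3/2})$ at every endpoint $\alpha$ of a main arc except fixed ones (hard edges). Put $p=-\tfrac12h^N_x$, $q=-\tfrac12h^N_t$. A point $z_0\in\mathbb R$ at which $h^N$ is analytic and $h^N_z(z_0)=h^N_{zz}(z_0)=0$ is called a real double point, and its velocity is $V=\frac{dq}{dp}=\frac{h^N_{tz}}{h^N_{xz}}$ at $z_0$. **(1)** Suppose that $h^N(z;x,t)$ is analytic in $z$ and $C^3$ in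 $(z,x,t)$ near $(z_0,x_b,t_b)$, with $z_0\in\mathbb R$, that a regular differentiable curve $(x,t)$ through $(x_b,t_b)$ (the breaking curve), together with a differentiable real function $z_0$ along it, satisfies $h^N_z(z_0)=h^N_{zz}(z_0)=0$, and that $dp\ne0$ at $z_0$. Then $dt\neq 0$ along the curve at $(x_b,t_b)$, and the velocity of the double point there is $$V=-\frac{dx}{dt},$$ so it is real. If moreover $dx\ne0$ along the curve and $h^N_{zzt}(z_0)\ne0$ there, then $\frac{dt}{dx}=-\frac{h^N_{zzz}\frac{dz_0}{dx}+h^N_{zzx}}{h^N_{zzt}}$. **(2)** Consider the box potential $q\,\chi_{[-L,L]}$ ($q,L>0$) in genus zero: $f_0(z)=-2Lz$, there is one main arc, the vertical segment from $-iq$ to $iq$, both of whose endpoints are fixed, and there are no complementary arcs. The $g$-function exists for all real $x,t$. For $x<L$ and $t>0$, a real $z_0$ is a double point of $h^0(\cdot\,;x,t)$ if and only if $$\frac{L-x}{t}=2\sqrt2\,q\quad\text{and}\quad z_0=\frac{q}{\sqrt2}.$$ So the breaking curve is $(L-x)/t=2\sqrt2\,q$, along it the double point $z_0=q/\sqrt2$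 is stationary, and there $dp\neq0$ and the velocity is $V=2\sqrt2\,q$. -/

import Mathlib

open Set Filter Topology
open scoped ComplexConjugate

noncomputable section

namespace FocusingNLS

/-- A simple oriented arc in the complex plane, parametrized by `[0,1]`, which is continuously
differentiable with nonzero velocity away from its endpoints and a finite exceptional set. -/
structure Arc where
  toFun : ℝ → ℂ
  exceptional : Finset ℝ
  continuousOn : ContinuousOn toFun (Icc 0 1)
  injOn : InjOn toFun (Icc 0 1)
  smooth : ∀ s ∈ Ioo (0 : ℝ) 1, s ∉ exceptional →
    ContDiffAt ℝ 1 toFun s ∧ deriv toFun s ≠ 0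

namespace Arc

/-- The closed arc as a set. -/
def trace (γ : Arc) : Set ℂ := γ.toFun '' Icc 0 1

/-- The arc without its endpoints. -/
def inner (γ : Arc) : Set ℂ := γ.toFun '' Ioo 0 1

/-- The two endpoints. -/
def endpoints (γ : Arc) : Set ℂ := {γ.toFun 0, γ.toFun 1}

/-- The regular parameters. -/
def regular (γ : Arc) : Set ℝ := {s | s ∈ Ioo (0 : ℝ) 1 ∧ s ∉ γ.exceptional}

/-- `g` has the boundary value `c` at `γ(s)` from the positive (left) side of the arc. The point
`γ(s') + δ i γ'(s')` lies to the left of the arc for small `δ > 0`. -/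
def HasLeftValue (γ : Arc) (g : ℂ → ℂ) (s : ℝ) (c : ℂ) : Prop :=
  Tendsto (fun p : ℝ × ℝ => g (γ.toFun p.1 + (p.2 : ℂ) * (Complex.I * deriv γ.toFun p.1)))
    (𝓝 s ×ˢ 𝓝[>] (0 : ℝ)) (𝓝 c)

/-- `g` has the boundary value `c` at `γ(s)` from the negative (right) side of the arc. -/
def HasRightValue (γ : Arc) (g : ℂ → ℂ) (s : ℝ) (c : ℂ) : Prop :=
  Tendsto (fun p : ℝ × ℝ => g (γ.toFun p.1 + (p.2 : ℂ) * (Complex.I * deriv γ.toFun p.1)))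
    (𝓝 s ×ˢ 𝓝[<] (0 : ℝ)) (𝓝 c)

end Arc

/-- A Schwarz symmetric contour of genus `N`: it has `N + 1` pairwise disjoint main arcs (bands),
whose `2N + 2` endpoints are the branchpoints, and `M` complementary arcs (gaps) that join
endpoints of main arcs. -/
structure Contour (N M : ℕ) where
  main : Fin (N + 1) → Arc
  gap : Fin M → Arc
  main_disjoint : ∀ i j, i ≠ j → Disjoint (main i).trace (main j).trace
  gap_main : ∀ k i, Disjoint (gap k).inner (main i).trace
  main_gap : ∀ i k, Disjoint (main i).inner (gap k).trace
  gap_disjoint : ∀ k l, k ≠ l → Disjoint (gap k).inner (gap l).trace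
  gap_endpoints : ∀ k, ∀ e ∈ (gap k).endpoints, ∃ i, e ∈ (main i).endpoints
  symm : ∀ z ∈ (⋃ i, (main i).trace) ∪ ⋃ k, (gap k).trace,
    conj z ∈ (⋃ i, (main i).trace) ∪ ⋃ k, (gap k).trace

/-- The union of all arcs of the contour. -/
def Contour.support {N M : ℕ} (C : Contour N M) : Set ℂ :=
  (⋃ i, (C.main i).trace) ∪ ⋃ k, (C.gap k).trace

/-- The input `f(z; x, t) = f₀(z) + 2 z x + 2 t z²` of the scalar Riemann-Hilbert problem. -/
def inputF (f₀ : ℂ → ℂ) (z : ℂ) (x t : ℝ) : ℂ := f₀ z + 2 * z * x + 2 * t * z ^ 2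

/-- `h = 2 g - f`. -/
def phaseH (f₀ : ℂ → ℂ) (g : ℝ → ℝ → ℂ → ℂ) (z : ℂ) (x t : ℝ) : ℂ :=
  2 * g x t z - inputF f₀ z x t

/-- `g` is the (Schwarz symmetric) `g`-function at the point `(x, t)` for the contour `C`: it
solves the scalar Riemann-Hilbert problem
`g₊ + g₋ = f + Wᵢ` on main arcs, `g₊ - g₋ = Ωₖ` on complementary arcs, with `g` analytic in the
rest of the Riemann sphere and with bounded boundary values, and the modulation equations
`Im h = O((z - α)^{3/2})` hold at every branchpoint `α` other than the fixed ones (hard edges). -/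
structure IsGFunction {N M : ℕ} (f₀ : ℂ → ℂ) (hard : Finset ℂ) (C : Contour N M)
    (W : Fin (N + 1) → ℝ) (Ω : Fin M → ℝ) (x t : ℝ) (g : ℂ → ℂ) : Prop where
  analytic_input : ∀ i, ∀ s ∈ (C.main i).regular, AnalyticAt ℂ f₀ ((C.main i).toFun s)
  symm_input : ∀ z : ℂ, z.im ≠ 0 → f₀ (conj z) = conj (f₀ z)
  analytic : DifferentiableOn ℂ g C.supportᶜ
  analytic_infinity : ∃ c, Tendsto g (Bornology.cobounded ℂ) (𝓝 c)
  bounded : ∃ B : ℝ, ∀ z ∈ C.supportᶜ, ‖g z‖ ≤ B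
  symm : ∀ z ∈ C.supportᶜ, g (conj z) = conj (g z)
  normalized : W 0 = 0
  jump_main : ∀ i, ∀ s ∈ (C.main i).regular, ∃ a b : ℂ,
    (C.main i).HasLeftValue g s a ∧ (C.main i).HasRightValue g s b ∧
      a + b = inputF f₀ ((C.main i).toFun s) x t + W i
  jump_gap : ∀ k, ∀ s ∈ (C.gap k).regular, ∃ a b : ℂ,
    (C.gap k).HasLeftValue g s a ∧ (C.gap k).HasRightValue g s b ∧ a - b = Ω k
  modulation : ∀ i, ∀ e ∈ (C.main i).endpoints, e ∉ hard →
    (fun z => (2 * g z - inputF f₀ z x t).im) =O[𝓝[C.supportᶜ] e]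
      fun z => ‖z - e‖ ^ (3 / 2 : ℝ)

/-- The real point `z₀` is a double point: `h` is analytic there and `h_z = h_zz = 0`. -/
def IsRealDoublePoint (h : ℂ → ℂ) (z₀ : ℝ) : Prop :=
  AnalyticAt ℂ h (z₀ : ℂ) ∧ deriv h (z₀ : ℂ) = 0 ∧ iteratedDeriv 2 h (z₀ : ℂ) = 0

section Potential

variable (h : ℂ → ℝ → ℝ → ℂ) (z : ℂ) (x t : ℝ)

/-- `p = -h_x / 2`. -/
def potP : ℂ := -(1 / 2) * deriv (fun x' => h z x' t) x

/-- `q = -h_t / 2`. -/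
def potQ : ℂ := -(1 / 2) * deriv (fun t' => h z x t') t

/-- The coefficient `dp/dz` of the differential `dp`. -/
def dpCoeff : ℂ := deriv (fun w => potP h w x t) z

/-- The coefficient `dq/dz` of the differential `dq`. -/
def dqCoeff : ℂ := deriv (fun w => potQ h w x t) z

/-- The velocity `V = dq/dp` of a double point. -/
def velocity : ℂ := dqCoeff h z x t / dpCoeff h z x t

/-- `h_zzz`. -/
def hZZZ : ℂ := iteratedDeriv 3 (fun w => h w x t) z

/-- `h_zzx`. -/
def hZZX : ℂ := deriv (fun x' => iteratedDeriv 2 (fun w => h w x' t) z) x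

/-- `h_zzt`. -/
def hZZT : ℂ := deriv (fun t' => iteratedDeriv 2 (fun w => h w x t') z) t

end Potential

/-- The upwards oriented vertical band from `-iq` to `iq`. -/
def boxArc (q : ℝ) (hq : 0 < q) : Arc where
  toFun s := ((q * (2 * s - 1) : ℝ) : ℂ) * Complex.I
  exceptional := ∅
  continuousOn := by fun_prop
  injOn := by
    intro a _ b _ hab
    have h1 : q * (2 * a - 1) = q * (2 * b - 1) := by
      have := congrArg Complex.im hab
      simpa using this
    have h2 := mul_left_cancel₀ hq.ne' h1
    linarith
  smooth := by
    intro s _ _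
    have hd : HasDerivAt (fun s : ℝ => ((q * (2 * s - 1) : ℝ) : ℂ) * Complex.I)
        (((q * (2 * 1) : ℝ) : ℂ) * Complex.I) s :=
      ((((hasDerivAt_id s).const_mul 2).sub_const 1).const_mul q).ofReal_comp.mul_const Complex.I
    refine ⟨?_, ?_⟩
    · have : ContDiff ℝ 1 (fun s : ℝ => (q * (2 * s - 1) : ℝ)) := by fun_prop
      exact ((Complex.ofRealCLM.contDiff.comp this).mul contDiff_const).contDiffAt
    · rw [hd.deriv]
      simp [hq.ne']

/-- The genus zero contour of the box potential: one vertical band from `-iq` to `iq`. -/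
def boxContour (q : ℝ) (hq : 0 < q) : Contour 0 0 where
  main _ := boxArc q hq
  gap := Fin.elim0
  main_disjoint i j hij := absurd (Fin.ext (by omega)) hij
  gap_main k := k.elim0
  main_gap _ k := k.elim0
  gap_disjoint k := k.elim0
  gap_endpoints k := k.elim0
  symm := by
    rintro z (hz | hz)
    · left
      obtain ⟨i, s, ⟨h0, h1⟩, rfl⟩ := mem_iUnion.1 hz
      refine mem_iUnion.2 ⟨i, 1 - s, ⟨by linarith, by linarith⟩, ?_⟩
      simp only [boxArc, map_mul, Complex.conj_ofReal, Complex.conj_I]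
      push_cast
      ring
    · obtain ⟨k, _⟩ := mem_iUnion.1 hz
      exact k.elim0

/-- For the box potential `q χ_[-L,L]`, `f₀(z) = -2 L z` on the genus zero band. -/
def boxF₀ (L : ℝ) (z : ℂ) : ℂ := -2 * L * z

/-- `g x t` is the genus zero `g`-function of the box potential at `(x, t)`; both branchpoints
`± iq` are fixed. -/
def IsBoxGFunction (q L : ℝ) (hq : 0 < q) (x t : ℝ) (g : ℂ → ℂ) : Prop :=
  IsGFunction (boxF₀ L) {q * Complex.I, -(q * Complex.I)} (boxContour q hq) 0 0 x t g

end FocusingNLS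

end

/-! For a moving double point, differentiate `h_z = 0` along the curve. The term `h_zz z₀'`
vanishes, leaving `h_zx X' + h_zt T' = 0`. Since `dp ≠ 0` means `h_zx ≠ 0`, regularity of the curve
forces `T' ≠ 0`, and the quotient is the velocity. Differentiating `h_zz = 0` gives the slope
formula. The analytic content is the exchange of a complex derivative in `z` with real derivatives
in `x, t` (`deriv_fderiv_apply`).

For the box, let `R = √(z² + q²)` be cut along the band. An explicit solution is `(t z - (L - x)) (z
- R)` (`isBoxGFunction_boxG`). It is the only one: the difference `d` of two bounded solutions has
opposite values on the two sides of the band, so `(z² + q²) d²` extends to an entire function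
vanishing at `± iq`. By Liouville `d²` is constant, hence so is `d` on the connected complement, and
the sign change makes it zero (`eq_zero_of_opposite_boundary_values`). Thus `h = -2 (t z - (L - x))
R` off the band, and `h_z` is a quadratic divided by `R`. A real double point away from `0` is a
double root of that quadratic; at `0`, which lies on the band, `h` jumps. -/

noncomputable section

namespace FocusingNLS

/-! ### Mixed complex and real partial derivatives. -/

section PartialDerivatives

/-- The complex derivative in the first variable. -/
def derivFst (K : ℂ × ℝ × ℝ → ℂ) (p : ℂ × ℝ × ℝ) : ℂ := deriv (fun w => K (w, p.2)) p.1

variable {K : ℂ × ℝ × ℝ → ℂ} {p : ℂ × ℝ × ℝ}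

/-- Restricted to the first factor, the real derivative is the complex derivative with scalars
restricted, hence a multiplication. -/
theorem fderiv_apply_fst (hK : DifferentiableAt ℝ K p)
    (hA : AnalyticAt ℂ (fun w => K (w, p.2)) p.1) (v : ℂ) :
    fderiv ℝ K p (v, 0) = v * derivFst K p := by
  have h1 : HasFDerivAt (fun w : ℂ => K (w, p.2))
      ((fderiv ℝ K p).comp (ContinuousLinearMap.inl ℝ ℂ (ℝ × ℝ))) p.1 := by
    have h0 : HasFDerivAt K (fderiv ℝ K p) ((fun w : ℂ => (w, p.2)) p.1) := hK.hasFDerivAt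
    exact h0.comp p.1 (hasFDerivAt_prodMk_left p.1 p.2)
  have h2 : HasFDerivAt (fun w : ℂ => K (w, p.2)) _ p.1 :=
    hA.differentiableAt.hasDerivAt.hasFDerivAt.restrictScalars ℝ
  have := congrArg (fun T : ℂ →L[ℝ] ℂ => T v) (h1.unique h2)
  simpa [derivFst] using this

theorem derivFst_eventuallyEq (hK : ∀ᶠ p' in 𝓝 p, DifferentiableAt ℝ K p')
    (hA : ∀ᶠ p' in 𝓝 p, AnalyticAt ℂ (fun w => K (w, p'.2)) p'.1) :
    derivFst K =ᶠ[𝓝 p] fun p' => fderiv ℝ K p' (1, 0) := by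
  filter_upwards [hK, hA] with p' h1 h2
  rw [fderiv_apply_fst h1 h2, one_mul]

theorem eventually_differentiableAt {n : ℕ} (hK : ContDiffAt ℝ (n + 1 : ℕ) K p) :
    ∀ᶠ p' in 𝓝 p, DifferentiableAt ℝ K p' := by
  filter_upwards [hK.eventually (by simp)] with p' h
  exact h.differentiableAt (by simp)

/-- Near `p` the complex derivative is the real directional derivative along `(1, 0)`, so exactly
one order of smoothness is spent. -/
theorem contDiffAt_derivFst {n : ℕ} (hK : ContDiffAt ℝ (n + 1 : ℕ) K p)
    (hA : ∀ᶠ p' in 𝓝 p, AnalyticAt ℂ (fun w => K (w, p'.2)) p'.1) :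
    ContDiffAt ℝ n (derivFst K) p := by
  refine ContDiffAt.congr_of_eventuallyEq ?_
    (derivFst_eventuallyEq (eventually_differentiableAt hK) hA)
  exact (hK.fderiv_right (by simp)).clm_apply contDiffAt_const

theorem eventually_analyticAt_derivFst
    (hA : ∀ᶠ p' in 𝓝 p, AnalyticAt ℂ (fun w => K (w, p'.2)) p'.1) :
    ∀ᶠ p' in 𝓝 p, AnalyticAt ℂ (fun w => derivFst K (w, p'.2)) p'.1 := by
  filter_upwards [hA] with p' h
  exact h.deriv

theorem deriv_snd_eq (hK : DifferentiableAt ℝ K p) :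
    deriv (fun x' => K (p.1, x', p.2.2)) p.2.1 = fderiv ℝ K p (0, 1, 0) := by
  have h0 : HasFDerivAt K (fderiv ℝ K p) ((fun x' : ℝ => (p.1, x', p.2.2)) p.2.1) :=
    hK.hasFDerivAt
  refine (h0.comp_hasDerivAt (f := fun x' : ℝ => (p.1, x', p.2.2)) p.2.1 ?_).deriv
  exact (hasDerivAt_const _ _).prodMk ((hasDerivAt_id _).prodMk (hasDerivAt_const _ _))

theorem deriv_thd_eq (hK : DifferentiableAt ℝ K p) :
    deriv (fun t' => K (p.1, p.2.1, t')) p.2.2 = fderiv ℝ K p (0, 0, 1) := by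
  have h0 : HasFDerivAt K (fderiv ℝ K p) ((fun t' : ℝ => (p.1, p.2.1, t')) p.2.2) :=
    hK.hasFDerivAt
  refine (h0.comp_hasDerivAt (f := fun t' : ℝ => (p.1, p.2.1, t')) p.2.2 ?_).deriv
  exact (hasDerivAt_const _ _).prodMk ((hasDerivAt_const _ _).prodMk (hasDerivAt_id _))

/-- The partial derivative of `K` in a parameter direction is holomorphic in the first variable,
and the derivatives can be exchanged. -/
theorem deriv_fderiv_apply (hK : ContDiffAt ℝ 2 K p)
    (hA : ∀ᶠ p' in 𝓝 p, AnalyticAt ℂ (fun w => K (w, p'.2)) p'.1) (u : ℝ × ℝ) :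
    deriv (fun w => fderiv ℝ K (w, p.2) (0, u)) p.1 = fderiv ℝ (derivFst K) p (0, u) := by
  have hK' : ContDiffAt ℝ ((1 : ℕ) + 1 : ℕ) K p := by exact_mod_cast hK
  have hd := eventually_differentiableAt hK'
  have hsymm : IsSymmSndFDerivAt ℝ K p := hK.isSymmSndFDerivAt (by simp)
  have hf : DifferentiableAt ℝ (fderiv ℝ K) p :=
    (hK.fderiv_right (m := 1) (by norm_num)).differentiableAt (by simp)
  have hF : DifferentiableAt ℝ (derivFst K) p :=
    (contDiffAt_derivFst hK' hA).differentiableAt (by simp)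
  -- Symmetry of the second derivative turns the `z`-derivative of a parameter derivative into a
  -- parameter derivative of `v * derivFst K`. The result is complex linear in `v`, which is the
  -- Cauchy-Riemann condition needed for `h2`.
  have key : ∀ v : ℂ, fderiv ℝ (fderiv ℝ K) p (v, 0) (0, u)
      = v * fderiv ℝ (derivFst K) p (0, u) := by
    intro v
    rw [hsymm]
    have e1 : (fun p' => fderiv ℝ K p' (v, 0)) =ᶠ[𝓝 p] fun p' => v * derivFst K p' := by
      filter_upwards [hd, hA] with p' h1 h2 using fderiv_apply_fst h1 h2 v
    have e2 : HasFDerivAt (fun p' => fderiv ℝ K p' (v, 0))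
        ((fderiv ℝ (fderiv ℝ K) p).flip (v, 0)) p := by
      simpa using hf.hasFDerivAt.clm_apply (hasFDerivAt_const (v, (0 : ℝ × ℝ)) p)
    have e3 := (hF.hasFDerivAt.const_mul v).congr_of_eventuallyEq e1
    have := congrArg (fun T : ℂ × ℝ × ℝ →L[ℝ] ℂ => T (0, u)) (e2.unique e3)
    simpa using this
  have h1 : HasFDerivAt (fun w : ℂ => fderiv ℝ K (w, p.2) (0, u))
      (((fderiv ℝ (fderiv ℝ K) p).flip (0, u)).comp (ContinuousLinearMap.inl ℝ ℂ (ℝ × ℝ)))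
      p.1 := by
    have h0 : HasFDerivAt (fun p' => fderiv ℝ K p' (0, u))
        ((fderiv ℝ (fderiv ℝ K) p).flip (0, u)) ((fun w : ℂ => (w, p.2)) p.1) := by
      simpa using hf.hasFDerivAt.clm_apply (hasFDerivAt_const ((0 : ℂ), u) p)
    exact h0.comp (f := fun w : ℂ => (w, p.2)) p.1 (hasFDerivAt_prodMk_left p.1 p.2)
  have h2 : HasDerivAt (fun w : ℂ => fderiv ℝ K (w, p.2) (0, u))
      (fderiv ℝ (derivFst K) p (0, u)) p.1 := by
    refine hasFDerivAt_of_restrictScalars ℝ h1 ?_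
    ext
    all_goals simp [key]
  exact h2.deriv

/-- Differentiation of an identity `K = 0` that holds along a curve. -/
theorem chain_rule_of_eventually_zero {X T Z : ℝ → ℝ} {s₀ : ℝ}
    (hK : DifferentiableAt ℝ K ((Z s₀ : ℂ), X s₀, T s₀))
    (hA : AnalyticAt ℂ (fun w => K (w, X s₀, T s₀)) (Z s₀))
    (hX : DifferentiableAt ℝ X s₀) (hT : DifferentiableAt ℝ T s₀)
    (hZ : DifferentiableAt ℝ Z s₀) (h0 : ∀ᶠ s in 𝓝 s₀, K ((Z s : ℂ), X s, T s) = 0) :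
    deriv Z s₀ * derivFst K ((Z s₀ : ℂ), X s₀, T s₀)
      + deriv X s₀ * fderiv ℝ K ((Z s₀ : ℂ), X s₀, T s₀) (0, 1, 0)
      + deriv T s₀ * fderiv ℝ K ((Z s₀ : ℂ), X s₀, T s₀) (0, 0, 1) = 0 := by
  have hc : HasDerivAt (fun s => ((Z s : ℂ), X s, T s))
      (((deriv Z s₀ : ℝ) : ℂ), deriv X s₀, deriv T s₀) s₀ :=
    hZ.hasDerivAt.ofReal_comp.prodMk (hX.hasDerivAt.prodMk hT.hasDerivAt)
  have h1 := hK.hasFDerivAt.comp_hasDerivAt s₀ hc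
  have h2 : HasDerivAt (K ∘ fun s => ((Z s : ℂ), X s, T s)) 0 s₀ :=
    (hasDerivAt_const s₀ (0 : ℂ)).congr_of_eventuallyEq h0
  have h3 := h1.unique h2
  -- Splitting the tangent vector isolates its `z`-component, on which the real derivative acts
  -- through `derivFst`.
  have h4 : (((deriv Z s₀ : ℝ) : ℂ), deriv X s₀, deriv T s₀)
      = (((deriv Z s₀ : ℝ) : ℂ), (0 : ℝ × ℝ)) + deriv X s₀ • ((0 : ℂ), (1 : ℝ), (0 : ℝ))
        + deriv T s₀ • ((0 : ℂ), (0 : ℝ), (1 : ℝ)) := by simp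
  rw [h4, map_add, map_add, map_smul, map_smul, fderiv_apply_fst hK hA] at h3
  simpa using h3

end PartialDerivatives

/-! ### Velocity of a double point and slope of the breaking curve. -/

section Breaking

variable {h : ℂ → ℝ → ℝ → ℂ} {z : ℂ} {x t : ℝ}

/-- The differential `dp` takes the `x`-derivative first, while the chain rule along the curve
produces `(h_z)_x`; the two orders agree. -/
theorem dpCoeff_eq (hK : ContDiffAt ℝ 2 (fun p : ℂ × ℝ × ℝ => h p.1 p.2.1 p.2.2) (z, x, t))
    (hA : ∀ᶠ p : ℂ × ℝ × ℝ in 𝓝 (z, x, t), AnalyticAt ℂ (fun w => h w p.2.1 p.2.2) p.1) :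
    dpCoeff h z x t = -(1 / 2) *
      fderiv ℝ (derivFst fun p : ℂ × ℝ × ℝ => h p.1 p.2.1 p.2.2) (z, x, t) (0, 1, 0) := by
  rw [← deriv_fderiv_apply hK hA, dpCoeff, ← deriv_const_mul_field]
  refine EventuallyEq.deriv_eq ?_
  have hd := eventually_differentiableAt (n := 1) (by exact_mod_cast hK)
  have hc : Tendsto (fun w : ℂ => (w, x, t)) (𝓝 z) (𝓝 (z, x, t)) :=
    (Continuous.prodMk_left (x, t)).tendsto z
  filter_upwards [hc.eventually hd] with w hw
  rw [potP, ← deriv_snd_eq hw]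

theorem dqCoeff_eq (hK : ContDiffAt ℝ 2 (fun p : ℂ × ℝ × ℝ => h p.1 p.2.1 p.2.2) (z, x, t))
    (hA : ∀ᶠ p : ℂ × ℝ × ℝ in 𝓝 (z, x, t), AnalyticAt ℂ (fun w => h w p.2.1 p.2.2) p.1) :
    dqCoeff h z x t = -(1 / 2) *
      fderiv ℝ (derivFst fun p : ℂ × ℝ × ℝ => h p.1 p.2.1 p.2.2) (z, x, t) (0, 0, 1) := by
  rw [← deriv_fderiv_apply hK hA, dqCoeff, ← deriv_const_mul_field]
  refine EventuallyEq.deriv_eq ?_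
  have hd := eventually_differentiableAt (n := 1) (by exact_mod_cast hK)
  have hc : Tendsto (fun w : ℂ => (w, x, t)) (𝓝 z) (𝓝 (z, x, t)) :=
    (Continuous.prodMk_left (x, t)).tendsto z
  filter_upwards [hc.eventually hd] with w hw
  rw [potQ, ← deriv_thd_eq hw]

/-- The velocity of a real double point that moves along a regular curve, and the slope of the
curve. -/
theorem velocity_of_realDoublePoint {X T Z : ℝ → ℝ} {s₀ : ℝ}
    (hC : ContDiffAt ℝ 3 (fun p : ℂ × ℝ × ℝ => h p.1 p.2.1 p.2.2) ((Z s₀ : ℂ), X s₀, T s₀))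
    (hA : ∀ᶠ p : ℂ × ℝ × ℝ in 𝓝 ((Z s₀ : ℂ), X s₀, T s₀),
      AnalyticAt ℂ (fun w => h w p.2.1 p.2.2) p.1)
    (hX : DifferentiableAt ℝ X s₀) (hT : DifferentiableAt ℝ T s₀) (hZ : DifferentiableAt ℝ Z s₀)
    (hreg : deriv X s₀ ≠ 0 ∨ deriv T s₀ ≠ 0)
    (hD : ∀ᶠ s in 𝓝 s₀, IsRealDoublePoint (fun w => h w (X s) (T s)) (Z s))
    (hdp : dpCoeff h (Z s₀) (X s₀) (T s₀) ≠ 0) :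
    deriv T s₀ ≠ 0 ∧
      velocity h (Z s₀) (X s₀) (T s₀) = ((-(deriv X s₀ / deriv T s₀) : ℝ) : ℂ) ∧
      (velocity h (Z s₀) (X s₀) (T s₀)).im = 0 ∧
      (deriv X s₀ ≠ 0 → hZZT h (Z s₀) (X s₀) (T s₀) ≠ 0 →
        ((deriv T s₀ / deriv X s₀ : ℝ) : ℂ) =
          -(hZZZ h (Z s₀) (X s₀) (T s₀) * ((deriv Z s₀ / deriv X s₀ : ℝ) : ℂ)
              + hZZX h (Z s₀) (X s₀) (T s₀)) / hZZT h (Z s₀) (X s₀) (T s₀)) := by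
  set K : ℂ × ℝ × ℝ → ℂ := fun p => h p.1 p.2.1 p.2.2 with hKdef
  set P : ℂ × ℝ × ℝ := ((Z s₀ : ℂ), X s₀, T s₀) with hP
  have hC2 : ContDiffAt ℝ 2 K P := hC.of_le (by norm_num)
  have hC' : ContDiffAt ℝ ((2 : ℕ) + 1 : ℕ) K P := by exact_mod_cast hC
  have hK1 : ContDiffAt ℝ ((1 : ℕ) + 1 : ℕ) (derivFst K) P := contDiffAt_derivFst hC' hA
  have hA1 := eventually_analyticAt_derivFst (K := K) hA
  have hK2 : ContDiffAt ℝ (1 : ℕ) (derivFst (derivFst K)) P := contDiffAt_derivFst hK1 hA1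
  have hA2 := eventually_analyticAt_derivFst hA1
  have hd1 : DifferentiableAt ℝ (derivFst K) P := hK1.differentiableAt (by simp)
  have hd2 : DifferentiableAt ℝ (derivFst (derivFst K)) P := hK2.differentiableAt (by simp)
  have e1 : ∀ᶠ s in 𝓝 s₀, derivFst K ((Z s : ℂ), X s, T s) = 0 := by
    filter_upwards [hD] with s hs using hs.2.1
  have it2 : ∀ (w : ℂ) (x t : ℝ), iteratedDeriv 2 (fun w => h w x t) w
      = derivFst (derivFst K) (w, x, t) := fun w x t => by
    rw [iteratedDeriv_succ, iteratedDeriv_one]; rfl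
  have e2 : ∀ᶠ s in 𝓝 s₀, derivFst (derivFst K) ((Z s : ℂ), X s, T s) = 0 := by
    filter_upwards [hD] with s hs
    rw [← it2]
    exact hs.2.2
  have c1 := chain_rule_of_eventually_zero hd1 hA1.self_of_nhds hX hT hZ e1
  have c2 := chain_rule_of_eventually_zero hd2 hA2.self_of_nhds hX hT hZ e2
  rw [← hP] at c1 c2
  -- At a double point `h_zz = 0`, so the motion of `z₀` itself drops out of the first identity.
  rw [show derivFst (derivFst K) P = 0 from e2.self_of_nhds, mul_zero, zero_add] at c1
  have hp := dpCoeff_eq hC2 hA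
  have hq := dqCoeff_eq hC2 hA
  rw [← hKdef, ← hP] at hp hq
  set a := fderiv ℝ (derivFst K) P (0, 1, 0)
  set b := fderiv ℝ (derivFst K) P (0, 0, 1)
  have ha : a ≠ 0 := by
    rintro h0
    exact hdp (by rw [hp, h0, mul_zero])
  have hT0 : deriv T s₀ ≠ 0 := by
    intro h0
    have hX0 : deriv X s₀ ≠ 0 := hreg.resolve_right (by simp [h0])
    rw [h0] at c1
    simp [ha, hX0] at c1
  have hTC : ((deriv T s₀ : ℝ) : ℂ) ≠ 0 := by exact_mod_cast hT0
  have hV : velocity h (Z s₀) (X s₀) (T s₀) = ((-(deriv X s₀ / deriv T s₀) : ℝ) : ℂ) := by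
    rw [velocity, hp, hq]
    push_cast
    field_simp
    linear_combination c1
  refine ⟨hT0, hV, by rw [hV, Complex.ofReal_im], fun hX0 hzzt => ?_⟩
  have hXC : ((deriv X s₀ : ℝ) : ℂ) ≠ 0 := by exact_mod_cast hX0
  have i3 : hZZZ h (Z s₀) (X s₀) (T s₀) = derivFst (derivFst (derivFst K)) P := by
    rw [hZZZ, iteratedDeriv_succ, funext fun w => it2 w (X s₀) (T s₀)]; rfl
  have ix : hZZX h (Z s₀) (X s₀) (T s₀) = fderiv ℝ (derivFst (derivFst K)) P (0, 1, 0) := by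
    rw [hZZX, ← deriv_snd_eq hd2]
    simp only [it2, hP]
  have it : hZZT h (Z s₀) (X s₀) (T s₀) = fderiv ℝ (derivFst (derivFst K)) P (0, 0, 1) := by
    rw [hZZT, ← deriv_thd_eq hd2]
    simp only [it2, hP]
  rw [← i3, ← ix, ← it] at c2
  push_cast
  field_simp
  linear_combination c2

end Breaking

/-! ### Removing singularities across the imaginary axis, and Liouville. -/

section EntireExtension

/-- A continuous function that is holomorphic off the imaginary axis is entire. -/
theorem differentiable_of_differentiableAt_re_ne_zero {f : ℂ → ℂ} (hc : Continuous f)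
    (hd : ∀ z : ℂ, z.re ≠ 0 → DifferentiableAt ℂ f z) : Differentiable ℂ f := by
  have hint : ∀ a b : ℝ, ∀ y : ℝ, IntervalIntegrable (fun x : ℝ => f (x + y * Complex.I))
      MeasureTheory.volume a b := fun a b y => by
    refine Continuous.intervalIntegrable ?_ a b
    fun_prop
  -- rectangles that do not cross the axis
  have aux : ∀ z w : ℂ, 0 ≤ z.re * w.re →
      (∫ x : ℝ in z.re..w.re, f (x + z.im * Complex.I))
        - (∫ x : ℝ in z.re..w.re, f (x + w.im * Complex.I))
        + Complex.I • (∫ y : ℝ in z.im..w.im, f (w.re + y * Complex.I))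
        - Complex.I • (∫ y : ℝ in z.im..w.im, f (z.re + y * Complex.I)) = 0 := by
    intro z w hzw
    refine Complex.integral_boundary_rect_eq_zero_of_continuousOn_of_differentiableOn f z w
      hc.continuousOn fun u hu => (hd u ?_).differentiableWithinAt
    obtain ⟨⟨h1, h2⟩, -⟩ := hu
    intro h0
    change u.re = 0 at h0
    rw [h0] at h1 h2
    rcases min_lt_iff.1 h1 with h1 | h1 <;> rcases lt_max_iff.1 h2 with h2 | h2 <;> nlinarith
  -- Morera: the imaginary axis splits any rectangle into two, each with vanishing boundary integral
  -- by `aux`; the contributions along the axis cancel.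
  have hcons : Complex.IsConservativeOn f univ := by
    intro z w _
    rw [← add_eq_zero_iff_eq_neg, Complex.wedgeIntegral_add_wedgeIntegral_eq]
    have a1 := aux z ⟨0, w.im⟩ (by simp)
    have a2 := aux ⟨0, z.im⟩ w (by simp)
    simp only at a1 a2
    rw [← intervalIntegral.integral_add_adjacent_intervals (hint z.re 0 z.im) (hint 0 w.re z.im),
      ← intervalIntegral.integral_add_adjacent_intervals (hint z.re 0 w.im) (hint 0 w.re w.im)]
    linear_combination a1 + a2
  exact differentiableOn_univ.1
    ((Complex.isConservativeOn_and_continuousOn_iff_isDifferentiableOn isOpen_univ).1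
      ⟨hcons, hc.continuousOn⟩)

/-- If `(z - a) (z - b) F(z)` extends to an entire function and `F` is bounded, then `F` is
constant. -/
theorem exists_const_of_mul_eq_entire {F G : ℂ → ℂ} {a b : ℂ} {A : Set ℂ} {B : ℝ}
    (hG : Differentiable ℂ G) (hab : a ≠ b) (ha : G a = 0) (hb : G b = 0) (hA : Dense A)
    (haA : a ∉ A) (hbA : b ∉ A) (hFG : ∀ z ∈ A, G z = (z - a) * (z - b) * F z)
    (hB : ∀ z ∈ A, ‖F z‖ ≤ B) : ∃ c, ∀ z ∈ A, F z = c := by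
  -- Two divided differences divide out the zeros at `a` and `b` while keeping the function entire.
  have h1 : Differentiable ℂ (dslope (dslope G a) b) := by
    rw [← differentiableOn_univ] at hG ⊢
    rw [Complex.differentiableOn_dslope univ_mem, Complex.differentiableOn_dslope univ_mem]
    exact hG
  have h2 : ∀ z ∈ A, dslope (dslope G a) b z = F z := by
    intro z hz
    have hza : z ≠ a := fun h => haA (h ▸ hz)
    have hzb : z ≠ b := fun h => hbA (h ▸ hz)
    have := sub_ne_zero.2 hza
    have := sub_ne_zero.2 hzb
    rw [dslope_of_ne _ hzb, slope_def_field, dslope_of_ne _ hza, dslope_of_ne _ hab.symm,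
      slope_def_field, slope_def_field, ha, hb, hFG z hz]
    field_simp
    simp
  -- The bound is known on `A` only; density and continuity carry it to the plane.
  have h3 : ∀ z, ‖dslope (dslope G a) b z‖ ≤ B := by
    have hcl : IsClosed {z | ‖dslope (dslope G a) b z‖ ≤ B} :=
      isClosed_le h1.continuous.norm continuous_const
    have hsub : A ⊆ {z | ‖dslope (dslope G a) b z‖ ≤ B} := fun z hz => by
      rw [mem_ofPred_eq, h2 z hz]
      exact hB z hz
    exact fun z => closure_minimal hsub hcl (hA z)
  have h4 : Bornology.IsBounded (range (dslope (dslope G a) b)) :=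
    (Metric.isBounded_closedBall (x := (0 : ℂ)) (r := B)).subset (by
      rintro _ ⟨z, rfl⟩
      simpa using h3 z)
  exact ⟨dslope (dslope G a) b 0, fun z hz => by
    rw [← h2 z hz, h1.apply_eq_apply_of_bounded h4 z 0]⟩

end EntireExtension

/-! ### The square root of `z² + q²` cut along the band. -/

section Root

/-- The square root with positive real part, analytic on `ℂ ∖ (-∞, 0]`. -/
def principalRoot (w : ℂ) : ℂ := Complex.exp (Complex.log w / 2)

/-- The branch on `ℂ ∖ [-iq, iq]` of `√(z² + q²)` that is asymptotic to `z` at infinity, divided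
by `z`. -/
def rootQuot (q : ℝ) (z : ℂ) : ℂ := principalRoot (1 + (q / z) ^ 2)

/-- The branch on `ℂ ∖ [-iq, iq]` of `√(z² + q²)` that is asymptotic to `z` at infinity. -/
def bandRoot (q : ℝ) (z : ℂ) : ℂ := z * rootQuot q z

/-- The closed segment from `-iq` to `iq`. -/
def band (q : ℝ) : Set ℂ := {z | z.re = 0 ∧ |z.im| ≤ q}

theorem principalRoot_sq {w : ℂ} (hw : w ≠ 0) : principalRoot w ^ 2 = w := by
  rw [principalRoot, ← Complex.exp_nat_mul]
  push_cast
  rw [mul_div_cancel₀ _ two_ne_zero, Complex.exp_log hw]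

/-- Off the cut the argument lies strictly between `-π` and `π`, so half of it has positive cosine.
-/
theorem principalRoot_re_pos {w : ℂ} (hw : w ∈ Complex.slitPlane) : 0 < (principalRoot w).re := by
  rw [principalRoot, Complex.exp_re]
  refine mul_pos (Real.exp_pos _) (Real.cos_pos_of_mem_Ioo ?_)
  have h1 := Complex.neg_pi_lt_arg w
  have h2 := (Complex.arg_le_pi w).lt_of_ne (Complex.slitPlane_arg_ne_pi hw)
  have h3 : (Complex.log w / 2).im = w.arg / 2 := by
    rw [show (2 : ℂ) = ((2 : ℝ) : ℂ) by norm_num, Complex.div_ofReal_im, Complex.log_im]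
  rw [h3]
  constructor <;> linarith

theorem differentiableAt_principalRoot {w : ℂ} (hw : w ∈ Complex.slitPlane) :
    DifferentiableAt ℂ principalRoot w :=
  ((Complex.differentiableAt_log hw).div_const 2).cexp

theorem conj_principalRoot {w : ℂ} (hw : w ∈ Complex.slitPlane) :
    principalRoot (conj w) = conj (principalRoot w) := by
  rw [principalRoot, principalRoot, Complex.log_conj _ (Complex.slitPlane_arg_ne_pi hw),
    ← Complex.exp_conj, map_div₀, Complex.conj_ofNat]

/-- A square root is determined by the sign of its real part. -/
theorem eq_of_sq_eq_sq_of_re_pos {a b : ℂ} (h : a ^ 2 = b ^ 2) (ha : 0 < a.re) (hb : 0 < b.re) :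
    a = b := by
  rcases sq_eq_sq_iff_eq_or_eq_neg.1 h with h | h
  · exact h
  · rw [h, Complex.neg_re] at ha
    linarith

variable {q : ℝ} {z : ℂ}

theorem ne_zero_of_notMem_band (hq : 0 < q) (hz : z ∉ band q) : z ≠ 0 := by
  rintro rfl
  exact hz ⟨rfl, by simpa using hq.le⟩

/-- If `1 + u² ≤ 0` with `u = q / z`, then `u` is purely imaginary with `|u| ≥ 1`, which puts `z` on
the band. -/
theorem one_add_div_sq_mem_slitPlane (hq : 0 < q) (hz : z ∉ band q) :
    1 + ((q : ℂ) / z) ^ 2 ∈ Complex.slitPlane := by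
  have h0 := ne_zero_of_notMem_band hq hz
  by_contra hcon
  rw [Complex.mem_slitPlane_iff, not_or, not_lt, not_not] at hcon
  obtain ⟨h1, h2⟩ := hcon
  set u : ℂ := (q : ℂ) / z with hu
  have h1' : 1 + (u.re * u.re - u.im * u.im) ≤ 0 := by simpa [pow_two] using h1
  have h2' : u.re * u.im + u.im * u.re = 0 := by simpa [pow_two] using h2
  have hui : u.im ≠ 0 := by
    intro h
    rw [h] at h1'
    nlinarith [mul_self_nonneg u.re]
  have hur : u.re = 0 := by
    have : u.re * u.im = 0 := by linarith
    exact (mul_eq_zero.1 this).resolve_right hui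
  have hzu : z * u = q := by rw [hu, mul_div_cancel₀ _ h0]
  have e1 := congrArg Complex.re hzu
  have e2 := congrArg Complex.im hzu
  simp only [Complex.mul_re, Complex.mul_im, hur, Complex.ofReal_re, Complex.ofReal_im,
    mul_zero, zero_sub, add_zero] at e1 e2
  have hzr : z.re = 0 := (mul_eq_zero.1 e2).resolve_right hui
  refine hz ⟨hzr, ?_⟩
  rw [hur] at h1'
  have h3 : |z.im| * |u.im| = q := by
    rw [← abs_mul, ← abs_of_pos hq, ← abs_neg, e1]
  have h4 : 1 ≤ |u.im| := by
    nlinarith [abs_mul_abs_self u.im, abs_nonneg u.im]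
  nlinarith [abs_nonneg z.im]

theorem bandRoot_sq (hq : 0 < q) (hz : z ∉ band q) : bandRoot q z ^ 2 = z ^ 2 + q ^ 2 := by
  have h0 := ne_zero_of_notMem_band hq hz
  have h1 : rootQuot q z ^ 2 = 1 + ((q : ℂ) / z) ^ 2 :=
    principalRoot_sq (Complex.slitPlane_ne_zero (one_add_div_sq_mem_slitPlane hq hz))
  rw [bandRoot, mul_pow, h1]
  field_simp

theorem differentiableAt_bandRoot (hq : 0 < q) (hz : z ∉ band q) :
    DifferentiableAt ℂ (bandRoot q) z := by
  have h0 := ne_zero_of_notMem_band hq hz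
  have h1 : DifferentiableAt ℂ (fun z : ℂ => 1 + ((q : ℂ) / z) ^ 2) z :=
    (((differentiableAt_const _).div differentiableAt_id h0).pow 2).const_add 1
  exact differentiableAt_id.mul
    (DifferentiableAt.comp z (differentiableAt_principalRoot
      (one_add_div_sq_mem_slitPlane hq hz)) h1)

theorem rootQuot_re_pos (hq : 0 < q) (hz : z ∉ band q) : 0 < (rootQuot q z).re :=
  principalRoot_re_pos (one_add_div_sq_mem_slitPlane hq hz)

theorem conj_bandRoot (hq : 0 < q) (hz : z ∉ band q) :
    bandRoot q (conj z) = conj (bandRoot q z) := by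
  have := conj_principalRoot (one_add_div_sq_mem_slitPlane hq hz)
  rw [bandRoot, bandRoot, map_mul, rootQuot, rootQuot, ← this]
  simp

theorem bandRoot_neg : bandRoot q (-z) = -bandRoot q z := by
  simp [bandRoot, rootQuot, div_neg]

theorem notMem_band_of_re_ne_zero (hz : z.re ≠ 0) : z ∉ band q := fun h => hz h.1

/-- This makes the principal root of `z² + q²` analytic across the open band, so that it can supply
the boundary values on both sides. -/
theorem sq_add_sq_mem_slitPlane (hz : z.re ≠ 0 ∨ |z.im| < q) :
    z ^ 2 + (q : ℂ) ^ 2 ∈ Complex.slitPlane := by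
  rw [Complex.mem_slitPlane_iff]
  have e1 : (z ^ 2 + (q : ℂ) ^ 2).re = z.re * z.re - z.im * z.im + q * q := by simp [pow_two]
  have e2 : (z ^ 2 + (q : ℂ) ^ 2).im = z.re * z.im + z.im * z.re := by simp [pow_two]
  rw [e1, e2]
  by_contra! hcon
  obtain ⟨h1, h2⟩ := hcon
  have h3 : z.re * z.im = 0 := by linarith
  rcases hz with hz | hz
  · have := (mul_eq_zero.1 h3).resolve_left hz
    rw [this] at h1
    have := mul_self_pos.2 hz
    nlinarith [mul_self_nonneg q]
  · nlinarith [abs_mul_abs_self z.im, mul_self_nonneg z.re, abs_nonneg z.im]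

/-- Both sides have the same square, so only the sign of the real part of `z S`, with `S = rootQuot
q z`, is at stake. From `S² - 1 = q² (conj z)² / |z|⁴`, the products `Re S · Im S` and `Re z · Im z`
have opposite signs (or vanish). As `Re S` and `Re z` are positive, `Im z · Im S ≤ 0`, hence `Re (z
S) > 0`. -/
theorem bandRoot_of_re_pos (hq : 0 < q) (hz : 0 < z.re) :
    bandRoot q z = principalRoot (z ^ 2 + q ^ 2) := by
  have hb : z ∉ band q := notMem_band_of_re_ne_zero hz.ne'
  have hs := sq_add_sq_mem_slitPlane (q := q) (Or.inl hz.ne')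
  refine eq_of_sq_eq_sq_of_re_pos ?_ ?_ (principalRoot_re_pos hs)
  · rw [bandRoot_sq hq hb, principalRoot_sq (Complex.slitPlane_ne_zero hs)]
  have h0 := ne_zero_of_notMem_band hq hb
  have hS := rootQuot_re_pos hq hb
  have h1 : z ^ 2 * rootQuot q z ^ 2 = z ^ 2 + q ^ 2 := by
    rw [← mul_pow]; exact bandRoot_sq hq hb
  set S := rootQuot q z
  have hsq : S ^ 2 - 1 = (q : ℂ) ^ 2 * conj z ^ 2 / (Complex.normSq z : ℂ) ^ 2 := by
    rw [← Complex.mul_conj]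
    have : conj z ≠ 0 := by simpa using h0
    field_simp
    linear_combination h1
  have hn : 0 < Complex.normSq z := Complex.normSq_pos.2 h0
  have him : S.re * S.im * Complex.normSq z ^ 2 = -(q ^ 2 * (z.re * z.im)) := by
    have h2 : (S ^ 2 - 1) * ((Complex.normSq z ^ 2 : ℝ) : ℂ) = ((q ^ 2 : ℝ) : ℂ) * conj z ^ 2 := by
      rw [hsq]
      have : (Complex.normSq z : ℂ) ≠ 0 := by exact_mod_cast hn.ne'
      push_cast
      field_simp
    have h3 := congrArg Complex.im h2
    rw [Complex.im_mul_ofReal, Complex.im_ofReal_mul] at h3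
    simp only [pow_two (S), pow_two (conj z), Complex.sub_im, Complex.one_im, Complex.mul_im,
      Complex.conj_re, Complex.conj_im, sub_zero] at h3
    linarith
  have hle : z.im * S.im ≤ 0 := by
    by_contra! hcon
    have p1 : 0 < (S.re * S.im * Complex.normSq z ^ 2) * (z.im * z.re) := by
      have : 0 < S.re * (z.im * S.im) * Complex.normSq z ^ 2 * z.re := by positivity
      linarith
    rw [him] at p1
    nlinarith [mul_nonneg (sq_nonneg q) (sq_nonneg (z.re * z.im))]
  rw [bandRoot, Complex.mul_re]
  nlinarith [mul_pos hz hS]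

theorem bandRoot_of_re_neg (hq : 0 < q) (hz : z.re < 0) :
    bandRoot q z = -principalRoot (z ^ 2 + q ^ 2) := by
  have h := bandRoot_of_re_pos (z := -z) hq (by simpa using hz)
  rw [bandRoot_neg, neg_sq] at h
  rw [← h, neg_neg]

end Root

/-! ### The explicit `g`-function of the box. -/

section Box

variable {q L x t : ℝ} {z : ℂ}

theorem boxArc_apply (hq : 0 < q) (s : ℝ) :
    (boxArc q hq).toFun s = ((q * (2 * s - 1) : ℝ) : ℂ) * Complex.I := rfl

theorem deriv_boxArc (hq : 0 < q) (s : ℝ) :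
    deriv (boxArc q hq).toFun s = ((q * 2 : ℝ) : ℂ) * Complex.I := by
  have hd : HasDerivAt (boxArc q hq).toFun (((q * (2 * 1) : ℝ) : ℂ) * Complex.I) s :=
    ((((hasDerivAt_id s).const_mul 2).sub_const 1).const_mul q).ofReal_comp.mul_const Complex.I
  rw [hd.deriv, mul_one]

/-- The band points upwards with speed `2q`, so its left normal is the negative real direction. -/
theorem boxArc_normal (hq : 0 < q) (p : ℝ × ℝ) :
    (boxArc q hq).toFun p.1 + (p.2 : ℂ) * (Complex.I * deriv (boxArc q hq).toFun p.1)
      = ⟨-(2 * q * p.2), q * (2 * p.1 - 1)⟩ := by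
  rw [deriv_boxArc, boxArc_apply]
  apply Complex.ext
  all_goals
    simp
  all_goals ring

theorem boxContour_support (hq : 0 < q) : (boxContour q hq).support = band q := by
  ext z
  simp only [Contour.support, mem_union, mem_iUnion]
  constructor
  · rintro (⟨i, s, ⟨h0, h1⟩, rfl⟩ | ⟨k, -⟩)
    · change ((q * (2 * s - 1) : ℝ) : ℂ) * Complex.I ∈ band q
      refine ⟨by simp, ?_⟩
      rw [Complex.im_ofReal_mul, Complex.I_im, mul_one, abs_le]
      constructor <;> nlinarith
    · exact k.elim0
  · rintro ⟨h0, h1⟩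
    rw [abs_le] at h1
    refine Or.inl ⟨0, (z.im / q + 1) / 2, ⟨?_, ?_⟩, ?_⟩
    · have : -1 ≤ z.im / q := by rw [le_div_iff₀ hq]; linarith
      linarith
    · have : z.im / q ≤ 1 := by rw [div_le_iff₀ hq]; linarith
      linarith
    · change ((q * (2 * ((z.im / q + 1) / 2) - 1) : ℝ) : ℂ) * Complex.I = z
      apply Complex.ext
      · simp [h0]
      · rw [Complex.im_ofReal_mul, Complex.I_im]
        field_simp
        ring

theorem isOpen_compl_band : IsOpen (band q)ᶜ := by
  refine IsClosed.isOpen_compl (self := ?_)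
  exact (isClosed_eq Complex.continuous_re continuous_const).inter
    (isClosed_le (continuous_abs.comp Complex.continuous_im) continuous_const)

theorem hasLeftValue_boxArc_iff (hq : 0 < q) {g : ℂ → ℂ} {s : ℝ} {c : ℂ} :
    (boxArc q hq).HasLeftValue g s c ↔
      Tendsto g (𝓝[{z | z.re < 0}] ((boxArc q hq).toFun s)) (𝓝 c) := by
  have hs : (boxArc q hq).toFun s = ⟨0, q * (2 * s - 1)⟩ := by
    simpa using boxArc_normal hq (s, 0)
  rw [Arc.HasLeftValue]
  simp_rw [boxArc_normal, hs]
  constructor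
  · intro h
    -- This map inverts the affine normal coordinates and carries the left half-plane to positive
    -- offsets.
    have hm : Tendsto (fun z : ℂ => ((z.im / q + 1) / 2, -z.re / (2 * q)))
        (𝓝[{z | z.re < 0}] (⟨0, q * (2 * s - 1)⟩ : ℂ)) (𝓝 s ×ˢ 𝓝[>] (0 : ℝ)) := by
      refine Tendsto.prodMk (Tendsto.mono_left ?_ nhdsWithin_le_nhds)
        (tendsto_nhdsWithin_iff.2 ⟨Tendsto.mono_left ?_ nhdsWithin_le_nhds, ?_⟩)
      · have : Continuous fun z : ℂ => (z.im / q + 1) / 2 := by fun_prop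
        convert this.tendsto _ using 2
        field_simp
        ring
      · have : Continuous fun z : ℂ => -z.re / (2 * q) := by fun_prop
        convert this.tendsto _ using 2
        simp
      · filter_upwards [self_mem_nhdsWithin] with z (hz : z.re < 0)
        exact div_pos (neg_pos.2 hz) (mul_pos two_pos hq)
    refine (h.comp hm).congr fun z => ?_
    simp only [Function.comp]
    congr 1
    apply Complex.ext <;> simp <;> field_simp
    ring
  · intro h
    refine h.comp (tendsto_nhdsWithin_iff.2 ⟨?_, ?_⟩)
    · have : Continuous fun p : ℝ × ℝ => (⟨-(2 * q * p.2), q * (2 * p.1 - 1)⟩ : ℂ) := by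
        simp_rw [← boxArc_normal hq, deriv_boxArc, boxArc_apply]
        fun_prop
      have h2 := this.tendsto (s, 0)
      rw [nhds_prod_eq] at h2
      simp only [mul_zero, neg_zero] at h2
      exact h2.mono_left (Filter.prod_mono le_rfl nhdsWithin_le_nhds)
    · filter_upwards [prod_mem_prod univ_mem self_mem_nhdsWithin] with p hp
      have : 0 < p.2 := hp.2
      change -(2 * q * p.2) < 0
      have : 0 < 2 * q * p.2 := by positivity
      linarith

theorem hasRightValue_boxArc_iff (hq : 0 < q) {g : ℂ → ℂ} {s : ℝ} {c : ℂ} :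
    (boxArc q hq).HasRightValue g s c ↔
      Tendsto g (𝓝[{z | 0 < z.re}] ((boxArc q hq).toFun s)) (𝓝 c) := by
  have hs : (boxArc q hq).toFun s = ⟨0, q * (2 * s - 1)⟩ := by
    simpa using boxArc_normal hq (s, 0)
  rw [Arc.HasRightValue]
  simp_rw [boxArc_normal, hs]
  constructor
  · intro h
    have hm : Tendsto (fun z : ℂ => ((z.im / q + 1) / 2, -z.re / (2 * q)))
        (𝓝[{z | 0 < z.re}] (⟨0, q * (2 * s - 1)⟩ : ℂ)) (𝓝 s ×ˢ 𝓝[<] (0 : ℝ)) := by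
      refine Tendsto.prodMk (Tendsto.mono_left ?_ nhdsWithin_le_nhds)
        (tendsto_nhdsWithin_iff.2 ⟨Tendsto.mono_left ?_ nhdsWithin_le_nhds, ?_⟩)
      · have : Continuous fun z : ℂ => (z.im / q + 1) / 2 := by fun_prop
        convert this.tendsto _ using 2
        field_simp
        ring
      · have : Continuous fun z : ℂ => -z.re / (2 * q) := by fun_prop
        convert this.tendsto _ using 2
        simp
      · filter_upwards [self_mem_nhdsWithin] with z (hz : 0 < z.re)
        exact div_neg_of_neg_of_pos (neg_lt_zero.2 hz) (mul_pos two_pos hq)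
    refine (h.comp hm).congr fun z => ?_
    simp only [Function.comp]
    congr 1
    apply Complex.ext <;> simp <;> field_simp
    ring
  · intro h
    refine h.comp (tendsto_nhdsWithin_iff.2 ⟨?_, ?_⟩)
    · have : Continuous fun p : ℝ × ℝ => (⟨-(2 * q * p.2), q * (2 * p.1 - 1)⟩ : ℂ) := by
        simp_rw [← boxArc_normal hq, deriv_boxArc, boxArc_apply]
        fun_prop
      have h2 := this.tendsto (s, 0)
      rw [nhds_prod_eq] at h2
      simp only [mul_zero, neg_zero] at h2
      exact h2.mono_left (Filter.prod_mono le_rfl nhdsWithin_le_nhds)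
    · filter_upwards [prod_mem_prod univ_mem self_mem_nhdsWithin] with p hp
      have : p.2 < 0 := hp.2
      change 0 < -(2 * q * p.2)
      have : 0 < 2 * q * -p.2 := mul_pos (mul_pos two_pos hq) (neg_pos.2 this)
      linarith

/-- The explicit genus zero `g`-function of the box potential. -/
def boxG (q L x t : ℝ) (z : ℂ) : ℂ := (t * z - (L - x)) * (z - bandRoot q z)

/-- Rationalizing `z - R = -q² / (z + R)` removes the cancellation at infinity and exhibits the
limit there. -/
theorem boxG_eq_div (hq : 0 < q) (hz : z ∉ band q) :
    boxG q L x t z = -(t - (L - x) / z) * q ^ 2 / (1 + rootQuot q z) := by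
  have h0 := ne_zero_of_notMem_band hq hz
  have h1 : 1 + rootQuot q z ≠ 0 := by
    intro h
    have := congrArg Complex.re h
    simp only [Complex.add_re, Complex.one_re, Complex.zero_re] at this
    linarith [rootQuot_re_pos hq hz]
  have h2 := bandRoot_sq hq hz
  rw [boxG]
  rw [bandRoot] at h2 ⊢
  field_simp
  linear_combination -(t * z - (L - x)) * h2

theorem tendsto_rootQuot_cobounded : Tendsto (rootQuot q) (Bornology.cobounded ℂ) (𝓝 1) := by
  have h1 : Tendsto (fun z : ℂ => 1 + ((q : ℂ) / z) ^ 2) (Bornology.cobounded ℂ) (𝓝 1) := by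
    have := ((tendsto_inv₀_cobounded (α := ℂ)).const_mul (q : ℂ)).pow 2 |>.const_add 1
    simpa [div_eq_mul_inv] using this
  have h2 := (differentiableAt_principalRoot Complex.one_mem_slitPlane).continuousAt.tendsto
  have h3 : principalRoot 1 = 1 := by simp [principalRoot]
  rw [h3] at h2
  exact h2.comp h1

theorem bounded_band_compl : ∀ᶠ z in Bornology.cobounded ℂ, z ∉ band q := by
  refine Bornology.isBounded_def.1 ((Metric.isBounded_closedBall (x := (0 : ℂ)) (r := |q|)).subset ?_)
  intro z hz
  have h1 := Complex.norm_le_abs_re_add_abs_im z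
  rw [hz.1, abs_zero, zero_add] at h1
  simpa using h1.trans (hz.2.trans (le_abs_self q))

theorem tendsto_boxG_cobounded (hq : 0 < q) :
    Tendsto (boxG q L x t) (Bornology.cobounded ℂ) (𝓝 (-t * q ^ 2 / 2)) := by
  have h1 : Tendsto (fun z : ℂ => -((t : ℂ) - (L - x) / z) * q ^ 2 / (1 + rootQuot q z))
      (Bornology.cobounded ℂ) (𝓝 (-((t : ℂ) - (L - x) * 0) * q ^ 2 / (1 + 1))) := by
    refine Tendsto.div ?_ (tendsto_rootQuot_cobounded.const_add 1) (by norm_num)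
    exact (((tendsto_inv₀_cobounded (α := ℂ)).const_mul _).const_sub _).neg.mul_const _
  have h2 : -((t : ℂ) - (L - x) * 0) * q ^ 2 / (1 + 1) = -t * q ^ 2 / 2 := by norm_num
  rw [h2] at h1
  refine h1.congr' ?_
  filter_upwards [bounded_band_compl (q := q)] with z hz
  exact (boxG_eq_div hq hz).symm

/-- In the unit disc both factors are bounded directly. Outside it, `|z - R| |z| |1 + R/z| = q²` and
`Re (R/z) > 0` show that `z - R` decays fast enough to absorb the linear factor. -/
theorem boxG_bounded (hq : 0 < q) : ∃ B : ℝ, ∀ z ∈ (band q)ᶜ, ‖boxG q L x t z‖ ≤ B := by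
  refine ⟨(|t| + |L - x|) * (2 + q + q ^ 2), fun z hz => ?_⟩
  have hR := bandRoot_sq hq hz
  have hlin : ‖(t : ℂ) * z - (L - x)‖ ≤ |t| * ‖z‖ + |L - x| := by
    refine (norm_sub_le _ _).trans ?_
    rw [norm_mul, Complex.norm_real, ← Complex.ofReal_sub, Complex.norm_real]
    simp
  have hab : 0 ≤ |t| + |L - x| := by positivity
  rw [boxG, norm_mul]
  rcases le_total ‖z‖ 1 with h1 | h1
  · have hRn : ‖bandRoot q z‖ ≤ 1 + q := by
      have : ‖bandRoot q z‖ ^ 2 ≤ 1 + q ^ 2 := by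
        rw [← norm_pow, hR]
        refine (norm_add_le _ _).trans ?_
        rw [norm_pow, norm_pow, Complex.norm_real, Real.norm_eq_abs, sq_abs]
        nlinarith [norm_nonneg z]
      nlinarith [norm_nonneg (bandRoot q z)]
    refine mul_le_mul ?_ ((norm_sub_le _ _).trans ?_) (norm_nonneg _) hab
    · nlinarith [abs_nonneg t]
    · nlinarith
  · have h0 := ne_zero_of_notMem_band hq hz
    have hS : 1 ≤ ‖1 + rootQuot q z‖ := by
      refine le_trans ?_ (Complex.re_le_norm _)
      simpa using (rootQuot_re_pos hq hz).le
    have hprod : ‖z - bandRoot q z‖ * (‖z‖ * ‖1 + rootQuot q z‖) = q ^ 2 := by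
      rw [← norm_mul, ← norm_mul]
      have : (z - bandRoot q z) * (z * (1 + rootQuot q z)) = -(q ^ 2) := by
        rw [bandRoot] at hR ⊢
        linear_combination -hR
      rw [this, norm_neg, norm_pow, Complex.norm_real, Real.norm_eq_abs, sq_abs]
    have hd : ‖z - bandRoot q z‖ * ‖z‖ ≤ q ^ 2 := by
      rw [← hprod, ← mul_assoc]
      exact le_mul_of_one_le_right (by positivity) hS
    have hlin' : ‖(t : ℂ) * z - (L - x)‖ ≤ (|t| + |L - x|) * ‖z‖ := by
      nlinarith [abs_nonneg (L - x)]
    calc ‖(t : ℂ) * z - (L - x)‖ * ‖z - bandRoot q z‖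
        ≤ (|t| + |L - x|) * ‖z‖ * ‖z - bandRoot q z‖ := by gcongr
      _ = (|t| + |L - x|) * (‖z - bandRoot q z‖ * ‖z‖) := by ring
      _ ≤ (|t| + |L - x|) * (2 + q + q ^ 2) := by
          gcongr
          linarith

theorem tendsto_boxG_left (hq : 0 < q) {w : ℂ} (hw : w.re = 0 ∧ |w.im| < q) :
    Tendsto (boxG q L x t) (𝓝[{z | z.re < 0}] w)
      (𝓝 ((t * w - (L - x)) * (w + principalRoot (w ^ 2 + q ^ 2)))) := by
  have hP : ContinuousAt (fun z : ℂ => principalRoot (z ^ 2 + (q : ℂ) ^ 2)) w :=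
    ContinuousAt.comp (f := fun z : ℂ => z ^ 2 + (q : ℂ) ^ 2)
      (differentiableAt_principalRoot (sq_add_sq_mem_slitPlane (Or.inr hw.2))).continuousAt
      (by fun_prop)
  have hc : ContinuousAt (fun z : ℂ => ((t : ℂ) * z - (L - x)) *
      (z + principalRoot (z ^ 2 + (q : ℂ) ^ 2))) w := by fun_prop
  refine (hc.tendsto.mono_left nhdsWithin_le_nhds).congr' ?_
  filter_upwards [self_mem_nhdsWithin] with z (hz : z.re < 0)
  rw [boxG, bandRoot_of_re_neg hq hz, sub_neg_eq_add]

theorem tendsto_boxG_right (hq : 0 < q) {w : ℂ} (hw : w.re = 0 ∧ |w.im| < q) :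
    Tendsto (boxG q L x t) (𝓝[{z | 0 < z.re}] w)
      (𝓝 ((t * w - (L - x)) * (w - principalRoot (w ^ 2 + q ^ 2)))) := by
  have hP : ContinuousAt (fun z : ℂ => principalRoot (z ^ 2 + (q : ℂ) ^ 2)) w :=
    ContinuousAt.comp (f := fun z : ℂ => z ^ 2 + (q : ℂ) ^ 2)
      (differentiableAt_principalRoot (sq_add_sq_mem_slitPlane (Or.inr hw.2))).continuousAt
      (by fun_prop)
  have hc : ContinuousAt (fun z : ℂ => ((t : ℂ) * z - (L - x)) *
      (z - principalRoot (z ^ 2 + (q : ℂ) ^ 2))) w := by fun_prop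
  refine (hc.tendsto.mono_left nhdsWithin_le_nhds).congr' ?_
  filter_upwards [self_mem_nhdsWithin] with z (hz : 0 < z.re)
  rw [boxG, bandRoot_of_re_pos hq hz]

theorem boxArc_mem_open_band (hq : 0 < q) {s : ℝ} (hs : s ∈ Ioo (0 : ℝ) 1) :
    ((boxArc q hq).toFun s).re = 0 ∧ |((boxArc q hq).toFun s).im| < q := by
  rw [boxArc_apply]
  refine ⟨by simp, ?_⟩
  rw [Complex.im_ofReal_mul, Complex.I_im, mul_one, abs_lt]
  constructor <;> nlinarith [hs.1, hs.2]

theorem isBoxGFunction_boxG (hq : 0 < q) : IsBoxGFunction q L hq x t (boxG q L x t) where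
  analytic_input i s _ := by
    unfold boxF₀
    fun_prop
  symm_input z _ := by simp [boxF₀, Complex.conj_ofNat]
  analytic := by
    rw [boxContour_support]
    intro z hz
    have hR := differentiableAt_bandRoot hq hz
    have h1 : DifferentiableAt ℂ (fun z : ℂ => (t : ℂ) * z - (L - x)) z := by fun_prop
    exact (h1.mul (differentiableAt_id.sub hR)).differentiableWithinAt
  analytic_infinity := ⟨_, tendsto_boxG_cobounded hq⟩
  bounded := by
    rw [boxContour_support]
    exact boxG_bounded hq
  symm z hz := by
    rw [boxContour_support] at hz
    simp [boxG, conj_bandRoot hq hz]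
  normalized := rfl
  jump_main i s hs := by
    -- The root enters the two boundary values with opposite signs, so their sum is `2 w (t w - (L -
    -- x)) = f(w)`.
    have hw := boxArc_mem_open_band hq hs.1
    refine ⟨_, _, (hasLeftValue_boxArc_iff hq).2 (tendsto_boxG_left hq hw),
      (hasRightValue_boxArc_iff hq).2 (tendsto_boxG_right hq hw), ?_⟩
    change _ = inputF (boxF₀ L) ((boxArc q hq).toFun s) x t + ((0 : ℝ) : ℂ)
    rw [inputF, boxF₀]
    push_cast
    ring
  jump_gap k := k.elim0
  modulation i e he hard := by
    -- Both endpoints are hard edges, so no modulation equation is imposed.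
    refine absurd ?_ hard
    rcases he with rfl | rfl
    · change (boxArc q hq).toFun 0 ∈ _
      rw [boxArc_apply]
      simp
    · change (boxArc q hq).toFun 1 ∈ _
      rw [boxArc_apply]
      norm_num

end Box

/-! ### Uniqueness of the box `g`-function. -/

section Uniqueness

variable {q L x t : ℝ}

/-- The complement is a union of four half-planes, each added one meeting those before it. -/
theorem isPreconnected_compl_band : IsPreconnected (band q)ᶜ := by
  have h1 : IsPreconnected {z : ℂ | 0 < z.re} := (convex_halfSpace_re_gt 0).isPreconnected
  have h2 : IsPreconnected {z : ℂ | z.re < 0} := (convex_halfSpace_re_lt 0).isPreconnected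
  have h3 : IsPreconnected {z : ℂ | q < z.im} := (convex_halfSpace_im_gt q).isPreconnected
  have h4 : IsPreconnected {z : ℂ | z.im < -q} := (convex_halfSpace_im_lt (-q)).isPreconnected
  have h13 := h1.union' (t := {z : ℂ | q < z.im})
    ⟨⟨1, q + 1⟩, by change (0 : ℝ) < 1; norm_num, by change q < q + 1; linarith⟩ h3
  have h132 := h13.union' (t := {z : ℂ | z.re < 0})
    ⟨⟨-1, q + 1⟩, Or.inr (by change q < q + 1; linarith), by change (-1 : ℝ) < 0; norm_num⟩ h2
  have h := h132.union' (t := {z : ℂ | z.im < -q})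
    ⟨⟨-1, -q - 1⟩, Or.inr (by change (-1 : ℝ) < 0; norm_num),
      by change -q - 1 < -q; linarith⟩ h4
  convert h using 1
  ext z
  change ¬(z.re = 0 ∧ |z.im| ≤ q) ↔ ((0 < z.re ∨ q < z.im) ∨ z.re < 0) ∨ z.im < -q
  rw [abs_le]
  grind

theorem dense_compl_band : Dense (band q)ᶜ := by
  have : Dense (Complex.re ⁻¹' {(0 : ℝ)}ᶜ) := (dense_compl_singleton (0 : ℝ)).preimage
    Complex.isOpenMap_re
  exact Dense.mono (fun _ hz => notMem_band_of_re_ne_zero hz) this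

theorem compl_band_nhdsWithin_le {w : ℂ} (hw : |w.im| < q) :
    𝓝[(band q)ᶜ] w ≤ 𝓝[{z | z.re < 0}] w ⊔ 𝓝[{z | 0 < z.re}] w := by
  rw [← nhdsWithin_union, nhdsWithin_le_iff]
  have h1 : {z : ℂ | |z.im| < q} ∈ 𝓝 w :=
    (isOpen_lt (continuous_abs.comp Complex.continuous_im) continuous_const).mem_nhds hw
  filter_upwards [mem_nhdsWithin_of_mem_nhds h1, self_mem_nhdsWithin] with z (h2 : |z.im| < q) h3
  exact lt_or_gt_of_ne fun h0 => h3 ⟨h0, h2.le⟩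

instance nhdsWithin_re_neg_neBot (y : ℝ) : (𝓝[{z : ℂ | z.re < 0}] ⟨0, y⟩).NeBot := by
  rw [← mem_closure_iff_nhdsWithin_neBot, Complex.closure_setOfPred_re_lt]
  exact le_refl (0 : ℝ)

instance nhdsWithin_re_pos_neBot (y : ℝ) : (𝓝[{z : ℂ | 0 < z.re}] ⟨0, y⟩).NeBot := by
  rw [← mem_closure_iff_nhdsWithin_neBot, Complex.closure_setOfPred_lt_re]
  exact le_refl (0 : ℝ)

/-- A bounded holomorphic function off the band whose boundary values on the two sides are
opposite vanishes. -/
theorem eq_zero_of_opposite_boundary_values (hq : 0 < q) {d : ℂ → ℂ} {B : ℝ}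
    (hd : DifferentiableOn ℂ d (band q)ᶜ) (hB : ∀ z ∈ (band q)ᶜ, ‖d z‖ ≤ B)
    (hj : ∀ y : ℝ, |y| < q → ∃ c, Tendsto d (𝓝[{z | z.re < 0}] ⟨0, y⟩) (𝓝 c) ∧
      Tendsto d (𝓝[{z | 0 < z.re}] ⟨0, y⟩) (𝓝 (-c))) :
    ∀ z ∈ (band q)ᶜ, d z = 0 := by
  set a : ℂ := q * Complex.I with ha
  have haband : a ∈ band q := ⟨by simp [ha], by simp [ha, abs_of_pos hq]⟩
  have hbband : -a ∈ band q := ⟨by simp [ha], by simp [ha, abs_of_pos hq]⟩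
  have hab : a ≠ -a := by
    intro h
    have := congrArg Complex.im h
    simp [ha] at this
    linarith
  -- Squaring removes the sign change across the band; the quadratic factor forces the limit `0` at
  -- the endpoints, where only boundedness of `d` is known.
  set Φ : ℂ → ℂ := fun z => (z - a) * (z - -a) * d z ^ 2 with hΦ
  have hpoly : Continuous fun z : ℂ => (z - a) * (z - -a) := by fun_prop
  have hΦc : DifferentiableOn ℂ Φ (band q)ᶜ := by
    have : DifferentiableOn ℂ (fun z : ℂ => (z - a) * (z - -a)) (band q)ᶜ := by fun_prop
    exact this.mul (hd.pow 2)
  have hend : ∀ w : ℂ, (w - a) * (w - -a) = 0 → Tendsto Φ (𝓝[(band q)ᶜ] w) (𝓝 0) := by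
    intro w hw
    have h1 : Tendsto (fun z : ℂ => ‖(z - a) * (z - -a)‖ * B ^ 2) (𝓝[(band q)ᶜ] w) (𝓝 0) := by
      have := (hpoly.norm.mul_const (B ^ 2)).tendsto w
      rw [hw, norm_zero, zero_mul] at this
      exact this.mono_left nhdsWithin_le_nhds
    refine squeeze_zero_norm' ?_ h1
    filter_upwards [self_mem_nhdsWithin] with z hz
    rw [hΦ, norm_mul _ (d z ^ 2), norm_pow]
    have := hB z hz
    gcongr
  have hlim : ∀ w, ∃ y, Tendsto Φ (𝓝[(band q)ᶜ] w) (𝓝 y) := by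
    intro w
    by_cases hw : w ∈ band q
    · rcases hw.2.lt_or_eq with him | him
      · have hw' : w = ⟨0, w.im⟩ := Complex.ext hw.1 rfl
        obtain ⟨c, hl, hr⟩ := hj w.im him
        rw [← hw'] at hl hr
        refine ⟨(w - a) * (w - -a) * c ^ 2, Tendsto.mono_left ?_ (compl_band_nhdsWithin_le him)⟩
        have hp := hpoly.tendsto w
        refine Tendsto.sup ((hp.mono_left nhdsWithin_le_nhds).mul (hl.pow 2)) ?_
        have := (hp.mono_left nhdsWithin_le_nhds).mul (hr.pow 2)
        rwa [neg_sq] at this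
      · refine ⟨0, hend w ?_⟩
        rcases (abs_eq hq.le).1 him with h | h
        · rw [show w = a from Complex.ext (by simp [ha, hw.1]) (by simp [ha, h]), sub_self,
            zero_mul]
        · rw [show w = -a from Complex.ext (by simp [ha, hw.1]) (by simp [ha, h]), sub_self,
            mul_zero]
    · exact ⟨_, hΦc.continuousOn w hw⟩
  set G := extendFrom (band q)ᶜ Φ with hGdef
  have hGΦ : ∀ z ∈ (band q)ᶜ, G z = Φ z := extendFrom_extends hΦc.continuousOn
  have hG : Differentiable ℂ G := by
    refine differentiable_of_differentiableAt_re_ne_zero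
      (continuous_extendFrom dense_compl_band hlim) fun z hz => ?_
    have hz' : (band q)ᶜ ∈ 𝓝 z := isOpen_compl_band.mem_nhds (notMem_band_of_re_ne_zero hz)
    refine (hΦc.differentiableAt hz').congr_of_eventuallyEq ?_
    filter_upwards [hz'] with w hw using hGΦ w hw
  have hGa : G a = 0 := extendFrom_eq (dense_compl_band a) (hend a (by simp))
  have hGb : G (-a) = 0 := extendFrom_eq (dense_compl_band (-a)) (hend (-a) (by simp))
  obtain ⟨c, hc⟩ := exists_const_of_mul_eq_entire (F := fun z => d z ^ 2) (B := B ^ 2) hG hab hGa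
    hGb dense_compl_band (fun h => h haband) (fun h => h hbband) hGΦ fun z hz => by
      rw [norm_pow]
      exact pow_le_pow_left₀ (norm_nonneg _) (hB z hz) 2
  have h1 : (1 : ℂ) ∈ (band q)ᶜ := notMem_band_of_re_ne_zero (by simp)
  by_cases hd1 : d 1 = 0
  · intro z hz
    have h2 := (hc z hz).trans (hc 1 h1).symm
    simpa [hd1] using h2
  · exfalso
    -- A constant square leaves a choice of sign, which connectedness fixes globally.
    have hconst : ∃ m, m ≠ 0 ∧ ∀ z ∈ (band q)ᶜ, d z = m := by
      rcases isPreconnected_compl_band.eq_or_eq_neg_of_sq_eq (g := fun _ => d 1) hd.continuousOn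
        continuousOn_const (fun z hz => (hc z hz).trans (hc 1 h1).symm) (fun _ => hd1) with h | h
      · exact ⟨_, hd1, h⟩
      · exact ⟨_, neg_ne_zero.2 hd1, h⟩
    obtain ⟨m, hm, hdm⟩ := hconst
    obtain ⟨b, hl, hr⟩ := hj 0 (by simpa using hq)
    have hl' : Tendsto d (𝓝[{z : ℂ | z.re < 0}] ⟨0, 0⟩) (𝓝 m) :=
      tendsto_const_nhds.congr' (by
        filter_upwards [self_mem_nhdsWithin] with z (hz : z.re < 0)
        exact (hdm z (notMem_band_of_re_ne_zero hz.ne)).symm)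
    have hr' : Tendsto d (𝓝[{z : ℂ | 0 < z.re}] ⟨0, 0⟩) (𝓝 m) :=
      tendsto_const_nhds.congr' (by
        filter_upwards [self_mem_nhdsWithin] with z (hz : 0 < z.re)
        exact (hdm z (notMem_band_of_re_ne_zero hz.ne')).symm)
    -- At the origin both one-sided limits equal `m` and yet are opposite, so `m = -m`.
    have e1 := tendsto_nhds_unique hl hl'
    have e2 := tendsto_nhds_unique hr hr'
    rw [e1] at e2
    exact hm (self_eq_neg.1 e2.symm)

theorem IsBoxGFunction.boundary_values {hq : 0 < q} {g : ℂ → ℂ}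
    (hg : IsBoxGFunction q L hq x t g) {y : ℝ} (hy : |y| < q) :
    ∃ a b : ℂ, Tendsto g (𝓝[{z | z.re < 0}] ⟨0, y⟩) (𝓝 a) ∧
      Tendsto g (𝓝[{z | 0 < z.re}] ⟨0, y⟩) (𝓝 b) ∧ a + b = inputF (boxF₀ L) ⟨0, y⟩ x t := by
  rw [abs_lt] at hy
  have hs : (y / q + 1) / 2 ∈ (boxArc q hq).regular := by
    have h1 : -1 < y / q := by rw [lt_div_iff₀ hq]; linarith
    have h2 : y / q < 1 := by rw [div_lt_iff₀ hq]; linarith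
    exact ⟨⟨by linarith, by linarith⟩, Finset.notMem_empty _⟩
  have hpt : (boxArc q hq).toFun ((y / q + 1) / 2) = ⟨0, y⟩ := by
    rw [boxArc_apply]
    apply Complex.ext
    · simp
    · rw [Complex.im_ofReal_mul, Complex.I_im]
      field_simp
      ring
  obtain ⟨a, b, hl, hr, hab⟩ := hg.jump_main 0 _ hs
  change (boxArc q hq).HasLeftValue g _ a at hl
  change (boxArc q hq).HasRightValue g _ b at hr
  change a + b = inputF (boxF₀ L) ((boxArc q hq).toFun _) x t + ((0 : ℝ) : ℂ) at hab
  rw [hasLeftValue_boxArc_iff, hpt] at hl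
  rw [hasRightValue_boxArc_iff, hpt] at hr
  rw [hpt, Complex.ofReal_zero, add_zero] at hab
  exact ⟨a, b, hl, hr, hab⟩

/-- Two solutions share the inhomogeneous term `f`, so it cancels in the jump relation of their
difference. -/
theorem IsBoxGFunction.eq_boxG {hq : 0 < q} {g : ℂ → ℂ} (hg : IsBoxGFunction q L hq x t g) :
    ∀ z ∉ band q, g z = boxG q L x t z := by
  have h0 : IsBoxGFunction q L hq x t (boxG q L x t) := isBoxGFunction_boxG hq
  obtain ⟨B, hB⟩ := hg.bounded
  obtain ⟨B', hB'⟩ := h0.bounded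
  have hd := hg.analytic.sub h0.analytic
  rw [boxContour_support] at hB hB' hd
  have key := eq_zero_of_opposite_boundary_values hq (B := B + B') hd
    (fun z hz => (norm_sub_le _ _).trans (add_le_add (hB z hz) (hB' z hz))) (fun y hy => by
      obtain ⟨a, b, hl, hr, hab⟩ := hg.boundary_values hy
      obtain ⟨a', b', hl', hr', hab'⟩ := h0.boundary_values hy
      refine ⟨a - a', hl.sub hl', ?_⟩
      rw [show -(a - a') = b - b' by linear_combination hab' - hab]
      exact hr.sub hr')
  exact fun z hz => sub_eq_zero.1 (key z hz)

end Uniqueness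

/-! ### Double points of the box phase. -/

section BoxDoublePoint

variable {q L x t : ℝ} {z : ℂ}

theorem bandRoot_ne_zero (hq : 0 < q) (hz : z ∉ band q) : bandRoot q z ≠ 0 := by
  intro h
  rcases mul_eq_zero.1 h with h | h
  · exact ne_zero_of_notMem_band hq hz h
  · exact Complex.exp_ne_zero _ h

/-- Differentiate `R² = z² + q²` and divide by `2R`. -/
theorem hasDerivAt_bandRoot (hq : 0 < q) (hz : z ∉ band q) :
    HasDerivAt (bandRoot q) (z / bandRoot q z) z := by
  have h1 := (differentiableAt_bandRoot hq hz).hasDerivAt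
  have h2 : HasDerivAt (fun w => bandRoot q w ^ 2) (2 * z) z := by
    have h3 : HasDerivAt (fun w : ℂ => w ^ 2 + (q : ℂ) ^ 2) (2 * z) z := by
      simpa using (hasDerivAt_pow 2 z).add_const ((q : ℂ) ^ 2)
    refine h3.congr_of_eventuallyEq ?_
    filter_upwards [isOpen_compl_band.mem_nhds hz] with w hw using bandRoot_sq hq hw
  have h4 := (h1.pow 2).unique h2
  have h5 := bandRoot_ne_zero hq hz
  have h6 : deriv (bandRoot q) z = z / bandRoot q z := by
    rw [eq_div_iff h5]
    norm_num at h4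
    linear_combination h4 / 2
  rwa [h6] at h1

/-- Off the band, `h = -2 (t z - (L - x)) R(z)`. -/
theorem phaseH_box {hq : 0 < q} {g : ℝ → ℝ → ℂ → ℂ} (hg : IsBoxGFunction q L hq x t (g x t))
    (hz : z ∉ band q) :
    phaseH (boxF₀ L) g z x t = -2 * (t * z - (L - x)) * bandRoot q z := by
  rw [phaseH, hg.eq_boxG z hz, boxG, inputF, boxF₀]
  ring

theorem hasDerivAt_boxPhase (hq : 0 < q) (hz : z ∉ band q) :
    HasDerivAt (fun w : ℂ => -2 * (t * w - (L - x)) * bandRoot q w)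
      (-2 * (2 * t * z ^ 2 - (L - x) * z + t * q ^ 2) / bandRoot q z) z := by
  have h1 : HasDerivAt (fun w : ℂ => -2 * (t * w - (L - x))) (-2 * (t * 1)) z :=
    (((hasDerivAt_id z).const_mul (t : ℂ)).sub_const _).const_mul (-2)
  refine (h1.mul (hasDerivAt_bandRoot hq hz)).congr_deriv ?_
  have h2 := bandRoot_sq hq hz
  have h3 := bandRoot_ne_zero hq hz
  field_simp
  linear_combination -t * h2

/-- Here `h_z = -2Q / R` with `Q` quadratic and `R` nonvanishing. Where `Q = 0`, `h_zz = -2Q' / R`,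
so the condition is a double root of `Q`. -/
theorem boxPhase_deriv_iff (hq : 0 < q) {f : ℂ → ℂ}
    (hf : ∀ z ∉ band q, f z = -2 * (t * z - (L - x)) * bandRoot q z) (hz : z ∉ band q) :
    deriv f z = 0 ∧ iteratedDeriv 2 f z = 0 ↔
      2 * t * z ^ 2 - (L - x) * z + t * q ^ 2 = 0 ∧ 4 * t * z - (L - x) = 0 := by
  have h3 := bandRoot_ne_zero hq hz
  have hd : ∀ w ∉ band q, deriv f w
      = -2 * (2 * t * w ^ 2 - (L - x) * w + t * q ^ 2) / bandRoot q w := fun w hw =>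
    ((hasDerivAt_boxPhase hq hw).congr_of_eventuallyEq (by
      filter_upwards [isOpen_compl_band.mem_nhds hw] with w hw using hf w hw)).deriv
  have hN : HasDerivAt (fun w : ℂ => -2 * (2 * t * w ^ 2 - (L - x) * w + t * (q : ℂ) ^ 2))
      (-2 * (4 * t * z - (L - x))) z := by
    have := ((((hasDerivAt_pow 2 z).const_mul (2 * t : ℂ)).sub
      ((hasDerivAt_id z).const_mul ((L : ℂ) - x))).add_const ((t : ℂ) * (q : ℂ) ^ 2)).const_mul (-2)
    refine this.congr_deriv ?_
    norm_num
    ring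
  have h2 : iteratedDeriv 2 f z = ((-2 * (4 * t * z - (L - x))) * bandRoot q z
      - -2 * (2 * t * z ^ 2 - (L - x) * z + t * q ^ 2) * (z / bandRoot q z))
        / bandRoot q z ^ 2 := by
    rw [iteratedDeriv_succ, iteratedDeriv_one]
    refine ((hN.div (hasDerivAt_bandRoot hq hz) h3).congr_of_eventuallyEq ?_).deriv
    filter_upwards [isOpen_compl_band.mem_nhds hz] with w hw using hd w hw
  rw [hd z hz, h2]
  constructor
  · rintro ⟨e1, e2⟩
    have e1' : 2 * t * z ^ 2 - (L - x) * z + t * q ^ 2 = 0 := by simpa [h3] using e1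
    refine ⟨e1', ?_⟩
    rw [e1'] at e2
    simpa [h3] using e2
  · rintro ⟨e1, e2⟩
    rw [e1, e2]
    simp

/-- Eliminating `L - x` gives `q² = 2 z₀²`; the positive root is selected by `4 t z₀ = L - x > 0`.
-/
theorem doublePoint_equations_iff (hq : 0 < q) (hx : x < L) (ht : 0 < t) (z₀ : ℝ) :
    (2 * t * z₀ ^ 2 - (L - x) * z₀ + t * q ^ 2 = 0 ∧ 4 * t * z₀ - (L - x) = 0) ↔
      (L - x) / t = 2 * √2 * q ∧ z₀ = q / √2 := by
  have h2 : √2 * √2 = 2 := Real.mul_self_sqrt (by norm_num)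
  have hp : 0 < √2 := by positivity
  constructor
  · rintro ⟨e1, e2⟩
    have hz : 0 < z₀ := by
      by_contra! h
      nlinarith
    have e3 : q ^ 2 = (√2 * z₀) ^ 2 := by
      have : t * q ^ 2 = t * (√2 * z₀) ^ 2 := by
        linear_combination e1 - z₀ * e2 - t * z₀ ^ 2 * h2
      exact mul_left_cancel₀ ht.ne' this
    have e4 : q = √2 * z₀ := by
      rwa [sq_eq_sq₀ hq.le (by positivity)] at e3
    refine ⟨?_, ?_⟩
    · rw [div_eq_iff ht.ne', e4]
      linear_combination -e2 - 2 * t * z₀ * h2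
    · rw [eq_div_iff hp.ne']
      linarith
  · rintro ⟨e1, e2⟩
    rw [div_eq_iff ht.ne'] at e1
    rw [eq_div_iff hp.ne'] at e2
    rw [e1, ← e2]
    constructor
    · linear_combination -t * z₀ ^ 2 * h2
    · linear_combination -2 * t * z₀ * h2

/-- The origin lies on the band, and `h` is not continuous there. -/
theorem not_continuousAt_zero_boxPhase (hq : 0 < q) (hx : x < L) {f : ℂ → ℂ}
    (hf : ∀ z ∉ band q, f z = -2 * (t * z - (L - x)) * bandRoot q z) : ¬ContinuousAt f 0 := by
  intro hc
  have hP : ContinuousAt (fun z : ℂ => principalRoot (z ^ 2 + (q : ℂ) ^ 2)) 0 :=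
    ContinuousAt.comp (f := fun z : ℂ => z ^ 2 + (q : ℂ) ^ 2)
      (differentiableAt_principalRoot
        (sq_add_sq_mem_slitPlane (Or.inr (by simpa using hq)))).continuousAt
      (by fun_prop)
  have hc' : ContinuousAt (fun z : ℂ => -2 * (t * z - (L - x)) *
      principalRoot (z ^ 2 + (q : ℂ) ^ 2)) 0 := by fun_prop
  have hr : Tendsto f (𝓝[{z : ℂ | 0 < z.re}] ⟨0, 0⟩) _ :=
    (hc'.tendsto.mono_left nhdsWithin_le_nhds).congr' (by
      filter_upwards [self_mem_nhdsWithin] with z (hz : 0 < z.re)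
      rw [hf z (notMem_band_of_re_ne_zero hz.ne'), bandRoot_of_re_pos hq hz])
  have hl : Tendsto f (𝓝[{z : ℂ | z.re < 0}] ⟨0, 0⟩) _ :=
    (hc'.neg.tendsto.mono_left nhdsWithin_le_nhds).congr' (by
      filter_upwards [self_mem_nhdsWithin] with z (hz : z.re < 0)
      rw [hf z (notMem_band_of_re_ne_zero hz.ne), bandRoot_of_re_neg hq hz]
      simp)
  have e1 := tendsto_nhds_unique hr (hc.tendsto.mono_left nhdsWithin_le_nhds)
  have e2 := tendsto_nhds_unique hl (hc.tendsto.mono_left nhdsWithin_le_nhds)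
  -- The one-sided limits are opposite, so continuity would make them vanish, although `L - x` and
  -- the root at `0` are nonzero.
  have e3 := self_eq_neg.1 (e1.trans e2.symm)
  have hLx : (L : ℂ) - x ≠ 0 := sub_ne_zero.2 (by exact_mod_cast hx.ne')
  have : principalRoot ((0 : ℂ) ^ 2 + (q : ℂ) ^ 2) ≠ 0 := Complex.exp_ne_zero _
  simp only [mul_zero, zero_sub, mul_eq_zero, neg_eq_zero, this, hLx, or_false] at e3
  norm_num at e3

theorem isRealDoublePoint_box_iff (hq : 0 < q) (hx : x < L) (ht : 0 < t) {f : ℂ → ℂ}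
    (hf : ∀ z ∉ band q, f z = -2 * (t * z - (L - x)) * bandRoot q z) (z₀ : ℝ) :
    IsRealDoublePoint f z₀ ↔ (L - x) / t = 2 * √2 * q ∧ z₀ = q / √2 := by
  -- The origin is the only real point of the band, hence the only one where the formula for `h` is
  -- unavailable.
  by_cases hz0 : z₀ = 0
  · subst hz0
    constructor
    · rintro ⟨ha, -⟩
      exact absurd (by simpa using ha.continuousAt) (not_continuousAt_zero_boxPhase hq hx hf)
    · rintro ⟨-, h⟩
      have : 0 < q / √2 := by positivity
      linarith
  · have hz : (z₀ : ℂ) ∉ band q := notMem_band_of_re_ne_zero (by simpa using hz0)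
    have han : AnalyticAt ℂ f z₀ := by
      refine DifferentiableOn.analyticAt (s := (band q)ᶜ) (fun w hw => ?_)
        (isOpen_compl_band.mem_nhds hz)
      refine ((hasDerivAt_boxPhase (L := L) (x := x) (t := t) hq hw).differentiableAt.congr_of_eventuallyEq
        ?_).differentiableWithinAt
      filter_upwards [isOpen_compl_band.mem_nhds hw] with w hw using hf w hw
    rw [← doublePoint_equations_iff hq hx ht, IsRealDoublePoint, and_iff_right han,
      boxPhase_deriv_iff hq hf hz]
    norm_cast

variable {h : ℂ → ℝ → ℝ → ℂ}

/-- Since `h` is affine in `x` and in `t`, the potentials are `p = R` and `q = z R`. The formula for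
`h` holds on an open set of `(x, t)`, which suffices for these derivatives. -/
theorem dpCoeff_box (hq : 0 < q) (hx : x < L) (ht : 0 < t)
    (hh : ∀ x t : ℝ, x < L → 0 < t → ∀ z ∉ band q,
      h z x t = -2 * (t * z - (L - x)) * bandRoot q z) (hz : z ∉ band q) :
    dpCoeff h z x t = z / bandRoot q z := by
  refine ((hasDerivAt_bandRoot hq hz).congr_of_eventuallyEq ?_).deriv
  filter_upwards [isOpen_compl_band.mem_nhds hz] with w hw
  have h1 : HasDerivAt (fun x' : ℝ => -2 * (t * w - ((L : ℂ) - (x' : ℂ))) * bandRoot q w)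
      (-2 * bandRoot q w) x := by
    have := (((((hasDerivAt_id x).ofReal_comp.const_sub (L : ℂ)).const_sub ((t : ℂ) * w)).const_mul
      (-2 : ℂ)).mul_const (bandRoot q w))
    simpa using this
  have h2 := h1.congr_of_eventuallyEq (f₁ := fun x' => h w x' t) (by
    filter_upwards [Iio_mem_nhds hx] with x' hx' using hh x' t hx' ht w hw)
  rw [potP, h2.deriv]
  ring

theorem dqCoeff_box (hq : 0 < q) (hx : x < L) (ht : 0 < t)
    (hh : ∀ x t : ℝ, x < L → 0 < t → ∀ z ∉ band q,
      h z x t = -2 * (t * z - (L - x)) * bandRoot q z) (hz : z ∉ band q) :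
    dqCoeff h z x t = bandRoot q z + z * (z / bandRoot q z) := by
  have h0 := (hasDerivAt_id z).mul (hasDerivAt_bandRoot hq hz)
  simp only [id_eq, one_mul] at h0
  refine (h0.congr_of_eventuallyEq ?_).deriv
  filter_upwards [isOpen_compl_band.mem_nhds hz] with w hw
  have h1 : HasDerivAt (fun t' : ℝ => -2 * ((t' : ℂ) * w - ((L : ℂ) - (x : ℂ))) * bandRoot q w)
      (-2 * w * bandRoot q w) t := by
    have := (((((hasDerivAt_id t).ofReal_comp.mul_const w).sub_const ((L : ℂ) - x)).const_mul
      (-2 : ℂ)).mul_const (bandRoot q w))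
    simpa using this
  have h2 := h1.congr_of_eventuallyEq (f₁ := fun t' => h w x t') (by
    filter_upwards [Ioi_mem_nhds ht] with t' ht' using hh x t' hx ht' w hw)
  rw [potQ, h2.deriv]
  simp only [Pi.mul_apply, id_eq]
  ring

/-- The quotient `(R + z²/R) / (z/R)` equals `(2z² + q²) / z`, and `2z² = q²` at the double point.
-/
theorem velocity_box (hq : 0 < q) (hx : x < L) (ht : 0 < t)
    (hh : ∀ x t : ℝ, x < L → 0 < t → ∀ z ∉ band q,
      h z x t = -2 * (t * z - (L - x)) * bandRoot q z) :
    dpCoeff h ((q / √2 : ℝ) : ℂ) x t ≠ 0 ∧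
      velocity h ((q / √2 : ℝ) : ℂ) x t = ((2 * √2 * q : ℝ) : ℂ) := by
  have hpos : 0 < q / √2 := by positivity
  have hz : ((q / √2 : ℝ) : ℂ) ∉ band q := notMem_band_of_re_ne_zero (by simpa using hpos.ne')
  have hR := bandRoot_ne_zero hq hz
  have hR2 := bandRoot_sq hq hz
  have hz0 : ((q / √2 : ℝ) : ℂ) ≠ 0 := by exact_mod_cast hpos.ne'
  rw [velocity, dpCoeff_box hq hx ht hh hz, dqCoeff_box hq hx ht hh hz]
  have hs : ((2 * √2 * q : ℝ) : ℂ) * ((q / √2 : ℝ) : ℂ) = 2 * (q : ℂ) ^ 2 := by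
    have : 2 * √2 * q * (q / √2) = 2 * q ^ 2 := by field_simp
    exact_mod_cast this
  have hzq : 2 * ((q / √2 : ℝ) : ℂ) ^ 2 = (q : ℂ) ^ 2 := by
    have : 2 * (q / √2) ^ 2 = q ^ 2 := by
      rw [div_pow, Real.sq_sqrt (by norm_num)]
      ring
    exact_mod_cast this
  generalize ((q / √2 : ℝ) : ℂ) = z at *
  refine ⟨div_ne_zero hz0 hR, ?_⟩
  rw [div_eq_iff (div_ne_zero hz0 hR), ← mul_div_assoc, ← mul_div_assoc, hs]
  field_simp
  linear_combination hR2 + hzq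

end BoxDoublePoint

end FocusingNLS

end

theorem mainTheorem8 :
    -- a real double point has the real velocity `-dx/dt`
    (∀ (N M : ℕ) (f₀ : ℂ → ℂ) (hard : Finset ℂ) (C : ℝ → ℝ → FocusingNLS.Contour N M)
      (W : ℝ → ℝ → Fin (N + 1) → ℝ) (Ω : ℝ → ℝ → Fin M → ℝ) (g : ℝ → ℝ → ℂ → ℂ)
      (h : ℂ → ℝ → ℝ → ℂ), h = FocusingNLS.phaseH f₀ g →
      -- the breaking curve `s ↦ (X s, T s)` with the real double points `Z s`
      ∀ (X T Z : ℝ → ℝ) (s₀ : ℝ),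
      (∀ᶠ p : ℝ × ℝ in 𝓝 (X s₀, T s₀),
        FocusingNLS.IsGFunction f₀ hard (C p.1 p.2) (W p.1 p.2) (Ω p.1 p.2) p.1 p.2
          (g p.1 p.2)) →
      -- `h` is smooth in `(z, x, t)` and analytic in `z` near the double point
      ContDiffAt ℝ 3 (fun p : ℂ × ℝ × ℝ => h p.1 p.2.1 p.2.2) ((Z s₀ : ℂ), X s₀, T s₀) →
      (∀ᶠ p : ℂ × ℝ × ℝ in 𝓝 ((Z s₀ : ℂ), X s₀, T s₀),
        AnalyticAt ℂ (fun w => h w p.2.1 p.2.2) p.1) →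
      DifferentiableAt ℝ X s₀ → DifferentiableAt ℝ T s₀ → DifferentiableAt ℝ Z s₀ →
      (deriv X s₀ ≠ 0 ∨ deriv T s₀ ≠ 0) →
      (∀ᶠ s in 𝓝 s₀, FocusingNLS.IsRealDoublePoint (fun w => h w (X s) (T s)) (Z s)) →
      FocusingNLS.dpCoeff h (Z s₀) (X s₀) (T s₀) ≠ 0 →
      deriv T s₀ ≠ 0 ∧
      FocusingNLS.velocity h (Z s₀) (X s₀) (T s₀) = ((-(deriv X s₀ / deriv T s₀) : ℝ) : ℂ) ∧
      (FocusingNLS.velocity h (Z s₀) (X s₀) (T s₀)).im = 0 ∧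
      (deriv X s₀ ≠ 0 → FocusingNLS.hZZT h (Z s₀) (X s₀) (T s₀) ≠ 0 →
        ((deriv T s₀ / deriv X s₀ : ℝ) : ℂ) =
          -(FocusingNLS.hZZZ h (Z s₀) (X s₀) (T s₀) * ((deriv Z s₀ / deriv X s₀ : ℝ) : ℂ)
              + FocusingNLS.hZZX h (Z s₀) (X s₀) (T s₀))
            / FocusingNLS.hZZT h (Z s₀) (X s₀) (T s₀))) ∧
    -- the box potential
    (∀ (q L : ℝ) (hq : 0 < q), 0 < L →
      (∃ g : ℝ → ℝ → ℂ → ℂ, ∀ x t : ℝ, FocusingNLS.IsBoxGFunction q L hq x t (g x t)) ∧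
      ∀ (g : ℝ → ℝ → ℂ → ℂ),
        (∀ x t : ℝ, x < L → 0 < t → FocusingNLS.IsBoxGFunction q L hq x t (g x t)) →
        ∀ (h : ℂ → ℝ → ℝ → ℂ), h = FocusingNLS.phaseH (FocusingNLS.boxF₀ L) g →
        ∀ x t : ℝ, x < L → 0 < t →
          (∀ z₀ : ℝ, FocusingNLS.IsRealDoublePoint (fun w => h w x t) z₀ ↔
            (L - x) / t = 2 * √2 * q ∧ z₀ = q / √2) ∧
          ((L - x) / t = 2 * √2 * q →
            FocusingNLS.dpCoeff h ((q / √2 : ℝ) : ℂ) x t ≠ 0 ∧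
            FocusingNLS.velocity h ((q / √2 : ℝ) : ℂ) x t = ((2 * √2 * q : ℝ) : ℂ))) := by
  refine ⟨?_, fun q L hq _ => ⟨⟨FocusingNLS.boxG q L,
    fun x t => FocusingNLS.isBoxGFunction_boxG hq⟩, ?_⟩⟩
  · rintro N M f₀ hard C W Ω g h - X T Z s₀ - hC hA hX hT hZ hreg hD hdp
    exact FocusingNLS.velocity_of_realDoublePoint hC hA hX hT hZ hreg hD hdp
  · rintro g hg h rfl x t hx ht
    have hh : ∀ x t : ℝ, x < L → 0 < t → ∀ z ∉ FocusingNLS.band q,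
        FocusingNLS.phaseH (FocusingNLS.boxF₀ L) g z x t
          = -2 * (t * z - (L - x)) * FocusingNLS.bandRoot q z :=
      fun x t hx ht z hz => FocusingNLS.phaseH_box (hg x t hx ht) hz
    exact ⟨FocusingNLS.isRealDoublePoint_box_iff hq hx ht (hh x t hx ht),
      fun _ => FocusingNLS.velocity_box hq hx ht hh⟩
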